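/- Let $n\ge 2$, $j\ge 1$ and $j\not\equiv 0 \pmod n$. Write $e_{ik}$ for the matrix units, $e_1=(1,0,\dots,0)^t$, $b=\sum_{i=1}^{n-1}e_{i+1,i}$, $J=e_{1n}\lambda+b$, and $V_n=\bigoplus_{i=1}^{n-1}\mathbb R e_{in}$. "Rapidly decaying" means Schwartz class. Central affine curves. Let $\mathcal M_n(\mathbb R)$ be the set of smooth curves $\gamma:\mathbb R\to\mathbb R^n\setminus\{0\}$ with $\det(\gamma,\gamma_x,\dots,\gamma_x^{(n-1)})=1$. The matrix $(\gamma,\gamma_x,\dots,\gamma_x^{(n-1)})$ is the central affine moving frame along $\gamma$, and $u_i=\det(\gamma,\dots,\gamma_x^{(i-2)},\gamma_x^{(n)},\gamma_x^{(i)},\dots,\gamma_x^{(n-1)})$, $1\le i\le n-1$, are its central affine curvatures; $u=\sum_{i=1}^{n-1}u_ie_{in}$ is also called the central affine curvature. The matrices $Z_{j,0}(u)$. For $u\in C^\infty(\mathbb R^2,V_n)$ let $Y(u,\lambda)=e_{1n}\lambda+\sum_{i\le 0}Y_i\lambda^i$, with $Y_i\in C^\infty(\mathbb R^2,sl(n,\mathbb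 R))$, be the formal series with $[\partial_x+J+u,\,Y(u,\lambda)]=0$ and $Y(u,\lambda)^n=\lambda I_n$. Let $Y_{j,0}(u)$ be the coefficient of $\lambda^0$ in $Y(u,\lambda)^j$, and put $Z_{j,0}(u)=Y_{j,0}(u)-\zeta_j(u)$, where $\zeta_j(u)$ is the smooth strictly upper triangular matrix-valued function such that $[\partial_x+b+u,\,Y_{j,0}(u)-\zeta_j(u)]\in V_n$. The flows. The $j$-th $A^{(1)}_{n-1}$-KdV flow is $u_t=[\partial_x+b+u,\,Z_{j,0}(u)]$, for $u\in C^\infty(\mathbb R^2,V_n)$. The $j$-th central affine curve flow is $\gamma_t=g\,Z_{j,0}(u)\,e_1$, for smooth $\gamma:\mathbb R^2\to\mathbb R^n$ with $\gamma(\cdot,t)\in\mathcal M_n(\mathbb R)$ for all $t$, where $g(\cdot,t)$ and $u(\cdot,t)$ are the central affine moving frame and the central affine curvature of $\gamma(\cdot,t)$. Theorem [Cauchy problem with rapidly decaying affine curvatures]. Let $\gamma_0\in\mathcal M_n(\mathbb R)$ have rapidly decaying central affine curvatures $u_1^0,\dots,u_{n-1}^0$, and let $g_0$ be its central affine moving frame.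 Let $u=\sum_{i=1}^{n-1}u_ie_{in}\in C^\infty(\mathbb R^2,V_n)$ be a solution of the $j$-th $A^{(1)}_{n-1}$-KdV flow with $u(x,0)=\sum_i u^0_i(x)e_{in}$, such that $u(\cdot,t)$ is rapidly decaying for every $t$. Then there is exactly one smooth $g:\mathbb R^2\to SL(n,\mathbb R)$ with $$g^{-1}g_x=b+u,\qquad g^{-1}g_t=Z_{j,0}(u),\qquad g(0,0)=g_0(0),$$ and $\gamma=g e_1$ is a solution of the $j$-th central affine curve flow with $\gamma(x,0)=\gamma_0(x)$ for all $x$. Moreover, for every $t$ the central affine curvatures of $\gamma(\cdot,t)$ are rapidly decaying. Finally, if $u$ is the only solution of its Cauchy problem in the class of solutions which are rapidly decaying in $x$ for every $t$, then $\gamma$ is the only solution of the $j$-th central affine curve flow with initial value $\gamma_0$ whose central affine curvatures are rapidly decaying in $x$ for every $t$. -/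

import Mathlib

open scoped ContDiff Matrix

noncomputable section

namespace CentralAffine

/-! ### Smooth matrix-valued functions of `(x, t)` -/

/-- All entries of the matrix-valued function `F(x, t)` are smooth on `ℝ²`. -/
def SmoothMat {n : ℕ} (F : ℝ → ℝ → Matrix (Fin n) (Fin n) ℝ) : Prop :=
  ∀ i k, ContDiff ℝ ∞ (fun p : ℝ × ℝ => F p.1 p.2 i k)

/-- The entrywise partial derivative `∂ₓ F`. -/
def dx {n : ℕ} (F : ℝ → ℝ → Matrix (Fin n) (Fin n) ℝ) (x t : ℝ) : Matrix (Fin n) (Fin n) ℝ :=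
  Matrix.of fun i k => deriv (fun y => F y t i k) x

/-- The entrywise partial derivative `∂ₜ F`. -/
def dt {n : ℕ} (F : ℝ → ℝ → Matrix (Fin n) (Fin n) ℝ) (x t : ℝ) : Matrix (Fin n) (Fin n) ℝ :=
  Matrix.of fun i k => deriv (fun s => F x s i k) t

/-- A function on the line is rapidly decaying if it is a Schwartz function. -/
def RapidlyDecaying (f : ℝ → ℝ) : Prop :=
  ∃ φ : SchwartzMap ℝ ℝ, (φ : ℝ → ℝ) = f

/-! ### Constant matrices and the space `Vₙ` -/

/-- The column vector `e₁ = (1, 0, …, 0)ᵗ`. -/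
def e1 (n : ℕ) : Fin n → ℝ := fun i => if i.val = 0 then 1 else 0

/-- `b = e₂₁ + e₃₂ + ⋯ + e_{n,n-1}` (indices are shifted by one in `Fin n`). -/
def bMat (n : ℕ) : Matrix (Fin n) (Fin n) ℝ :=
  Matrix.of fun i k => if i.val = k.val + 1 then 1 else 0

/-- The matrix unit `e_{1n}`. -/
def e1n (n : ℕ) : Matrix (Fin n) (Fin n) ℝ :=
  Matrix.of fun i k => if i.val = 0 ∧ k.val + 1 = n then 1 else 0

/-- The element `∑_{i=1}^{n-1} vᵢ e_{in}` of `Vₙ` with coordinates `v₁, …, v_{n-1}`. -/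
def toV (n : ℕ) (v : Fin (n - 1) → ℝ) : Matrix (Fin n) (Fin n) ℝ :=
  Matrix.of fun i k =>
    if k.val + 1 = n then (if h : i.val < n - 1 then v ⟨i.val, h⟩ else 0) else 0

/-! ### Central affine curves -/

/-- The matrix `(γ, γₓ, …, γₓ^{(n-1)})`, the `k`-th column being the `k`-th derivative. -/
def frame {n : ℕ} (γ : ℝ → Fin n → ℝ) (x : ℝ) : Matrix (Fin n) (Fin n) ℝ :=
  Matrix.of fun i k => iteratedDeriv k.val γ x i

/-- The space `𝓜ₙ(ℝ)` of smooth curves with `det (γ, γₓ, …, γₓ^{(n-1)}) = 1`, that is, of curves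
parametrized by central affine arc length. (Such a curve never meets the origin if `n ≥ 1`.) -/
def IsCentralAffineCurve {n : ℕ} (γ : ℝ → Fin n → ℝ) : Prop :=
  ContDiff ℝ ∞ γ ∧ ∀ x, (frame γ x).det = 1

/-- The central affine curvatures
`uᵢ = det (γ, …, γₓ^{(i-2)}, γₓ^{(n)}, γₓ^{(i)}, …, γₓ^{(n-1)})`, `1 ≤ i ≤ n - 1`. -/
def curvature {n : ℕ} (γ : ℝ → Fin n → ℝ) (x : ℝ) : Fin (n - 1) → ℝ := fun i =>
  ((frame γ x).updateCol ⟨i.val, by omega⟩ (iteratedDeriv n γ x)).det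

/-! ### The `A⁽¹⁾_{n-1}`-KdV hierarchy

A formal series `∑_{i ≤ i₀} ξᵢ λⁱ` with matrix coefficients is a Laurent series in the variable
`λ⁻¹`: the coefficient of `λⁱ` is `coeff (-i)`. -/

/-- `J + u = e_{1n} λ + b + u`, where `u = ∑ vᵢ e_{in}`. -/
def laxSeries (n : ℕ) (v : Fin (n - 1) → ℝ) : LaurentSeries (Matrix (Fin n) (Fin n) ℝ) :=
  HahnSeries.single (-1) (e1n n) + HahnSeries.single 0 (bMat n + toV n v)

/-- `Y = Y(u, λ)`: the series with smooth coefficients in `sl(n, ℝ)` such that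
`[∂ₓ + J + u, Y] = 0` and `Yⁿ = λ Iₙ`. These equations determine `Y` up to an `n`-th root of unity
(over `ℝ`: up to sign, for even `n`), which is fixed by the leading term `Y = e_{1n} λ + O(1)`. -/
structure IsLaxRoot {n : ℕ} (u : ℝ → ℝ → Fin (n - 1) → ℝ)
    (Y : ℝ → ℝ → LaurentSeries (Matrix (Fin n) (Fin n) ℝ)) : Prop where
  smooth : ∀ m : ℤ, SmoothMat fun x t => (Y x t).coeff m
  trace_eq_zero : ∀ (x t : ℝ) (m : ℤ), ((Y x t).coeff m).trace = 0
  coeff_eq_zero : ∀ (x t : ℝ) (m : ℤ), m < -1 → (Y x t).coeff m = 0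
  leading : ∀ x t : ℝ, (Y x t).coeff (-1) = e1n n
  commute : ∀ (x t : ℝ) (m : ℤ), dx (fun y s => (Y y s).coeff m) x t +
    (laxSeries n (u x t) * Y x t - Y x t * laxSeries n (u x t)).coeff m = 0
  pow_eq : ∀ x t : ℝ, Y x t ^ n = HahnSeries.single (-1) 1

/-- `[∂ₓ + b + u, C] = Cₓ + [b + u, C]`. -/
def bracket {n : ℕ} (u : ℝ → ℝ → Fin (n - 1) → ℝ) (C : ℝ → ℝ → Matrix (Fin n) (Fin n) ℝ)
    (x t : ℝ) : Matrix (Fin n) (Fin n) ℝ :=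
  dx C x t + ((bMat n + toV n (u x t)) * C x t - C x t * (bMat n + toV n (u x t)))

/-- `Z = Z_{j,0}(u)`, i.e. `Z = Y_{j,0}(u) - ζ_j(u)`, where `Y_{j,0}(u)` is the coefficient of `λ⁰`
in `Y(u, λ)ʲ`, and `ζ_j(u)` is the strictly upper triangular matrix-valued function for which
`[∂ₓ + b + u, Y_{j,0}(u) - ζ_j(u)]` takes values in `Vₙ`. -/
def IsZ {n : ℕ} (j : ℕ) (u : ℝ → ℝ → Fin (n - 1) → ℝ)
    (Z : ℝ → ℝ → Matrix (Fin n) (Fin n) ℝ) : Prop :=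
  ∃ (Y : ℝ → ℝ → LaurentSeries (Matrix (Fin n) (Fin n) ℝ))
    (ζ : ℝ → ℝ → Matrix (Fin n) (Fin n) ℝ),
    IsLaxRoot u Y ∧
    SmoothMat ζ ∧
    (∀ x t i k, k ≤ i → ζ x t i k = 0) ∧
    (∀ x t, Z x t = (Y x t ^ j).coeff 0 - ζ x t) ∧
    ∀ x t, ∃ v : Fin (n - 1) → ℝ, bracket u Z x t = toV n v

/-- `u ∈ C^∞(ℝ², Vₙ)` solves the `j`-th `A⁽¹⁾_{n-1}`-KdV flow `uₜ = [∂ₓ + b + u, Z_{j,0}(u)]`. -/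
def IsKdVSolution {n : ℕ} (j : ℕ) (u : ℝ → ℝ → Fin (n - 1) → ℝ) : Prop :=
  ContDiff ℝ ∞ (fun p : ℝ × ℝ => u p.1 p.2) ∧
  ∃ Z, IsZ j u Z ∧ ∀ x t, dt (fun y s => toV n (u y s)) x t = bracket u Z x t

/-- `u` is a solution on `ℝ²`, within the class of potentials which are rapidly decaying in `x` at
each time, of the Cauchy problem for the `j`-th `A⁽¹⁾_{n-1}`-KdV flow with initial value `u₀`. -/
def SolvesKdVCauchy {n : ℕ} (j : ℕ) (u₀ : ℝ → Fin (n - 1) → ℝ)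
    (u : ℝ → ℝ → Fin (n - 1) → ℝ) : Prop :=
  IsKdVSolution j u ∧ (∀ t i, RapidlyDecaying fun x => u x t i) ∧ ∀ x, u x 0 = u₀ x

/-- `g : ℝ² → SL(n, ℝ)` solves the system `g⁻¹ gₓ = b + u`, `g⁻¹ gₜ = Z_{j,0}(u)`. -/
def IsLaxFrame {n : ℕ} (j : ℕ) (u : ℝ → ℝ → Fin (n - 1) → ℝ)
    (g : ℝ → ℝ → Matrix (Fin n) (Fin n) ℝ) : Prop :=
  SmoothMat g ∧ (∀ x t, (g x t).det = 1) ∧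
  (∀ x t, (g x t)⁻¹ * dx g x t = bMat n + toV n (u x t)) ∧
  ∃ Z, IsZ j u Z ∧ ∀ x t, (g x t)⁻¹ * dt g x t = Z x t

/-- `γ` is a smooth solution of the `j`-th central affine curve flow `γₜ = g Z_{j,0}(u) e₁` on
`𝓜ₙ(ℝ)`, where `g(·, t)` and `u(·, t)` are the central affine moving frame and curvature along
`γ(·, t)`. -/
def IsCurveFlowSolution {n : ℕ} (j : ℕ) (γ : ℝ → ℝ → Fin n → ℝ) : Prop :=
  ContDiff ℝ ∞ (fun p : ℝ × ℝ => γ p.1 p.2) ∧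
  (∀ t, IsCentralAffineCurve fun x => γ x t) ∧
  ∃ Z, IsZ j (fun x t => curvature (fun y => γ y t) x) Z ∧
    ∀ x t, deriv (fun s => γ x s) t = (frame (fun y => γ y t) x * Z x t) *ᵥ e1 n

end CentralAffine

end

namespace CentralAffine

/-! ### Linear ordinary differential equations: existence, Grönwall, uniqueness. -/

section LinearSystems

open MeasureTheory Set Filter Topology

/-! The KdV flow is the zero curvature condition for `A = b + u` and `Z`, so the linear system `gₓ =
g A`, `gₜ = g Z` is solvable with any value at the origin (`exists_frobenius`) and its solution is
unique. Both coefficients have trace zero, so `det g` stays `1`. Right multiplication by `b + u`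
moves each column to the next one under `∂ₓ`; hence the columns of `g` are the successive
derivatives of `γ = g e₁`, its moving frame is `g` and, by Cramer's rule, its curvature is `u`. Then
`γₜ = gₜ e₁ = g Z e₁`, and `γ(·, 0) = γ₀` because both frames solve the same linear equation at `t =
0`.

Conversely, for any solution of the curve flow put `C = g⁻¹ gₜ`, where `g` is its frame. Equality of
the mixed derivatives gives `vₜ = [∂ₓ + b + v, C]` for its curvature `v`, so this bracket lies in
`Vₙ`. Such a matrix is determined by its first column (`eq_of_bracket_mem`), and the flow says that
`C` and `Z` have the same first column. Hence `C = Z`, `v` solves the KdV flow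
(`IsCurveFlowSolution.isKdVSolution`), and uniqueness for KdV passes to uniqueness for curves.

Two algebraic facts about `Z` are needed. Its trace vanishes because `Yⁿ = λ` makes the trace of
`Yʲ` a multiple of `λ^{j/n}`, without constant term for `j ≠ 0` (`trace_coeff_zero_pow`). And `Z` is
unique (`IsZ.unique`), so that two frames or flows given with different witnesses can be compared.
This rests on uniqueness of `Y` (`IsLaxRoot.unique`), proved degree by degree in the principal
grading, where the top part of `J + u` is a cyclic permutation matrix. -/

theorem exists_norm_le_of_continuous {E : Type*} [NormedAddCommGroup E] {A : ℝ → E}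
    (hA : Continuous A) (r : ℝ) :
    ∃ K, 1 ≤ K ∧ ∀ x, |x| ≤ r → ‖A x‖ ≤ K := by
  obtain ⟨K, hK⟩ := (isCompact_Icc (a := -r) (b := r)).exists_bound_of_continuousOn
    hA.continuousOn
  exact ⟨max K 1, le_max_right _ _, fun x hx => (hK x (abs_le.1 hx)).trans (le_max_left _ _)⟩

variable {R : Type*} [NormedRing R] [NormedAlgebra ℝ R]

/-- The terms of the Peano–Baker series of the linear equation `F' = F A`, `F 0 = c`. -/
noncomputable def peanoBaker (A : ℝ → R) (c : R) : ℕ → ℝ → R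
  | 0 => fun _ => c
  | k + 1 => fun x => ∫ s in (0 : ℝ)..x, peanoBaker A c k s * A s

theorem continuous_peanoBaker {A : ℝ → R} (hA : Continuous A) (c : R) (k : ℕ) :
    Continuous (peanoBaker A c k) := by
  induction k with
  | zero => exact continuous_const
  | succ k ih =>
    exact intervalIntegral.continuous_primitive
      (fun a b => (ih.mul hA).intervalIntegrable a b) 0

theorem hasDerivAt_peanoBaker_succ [CompleteSpace R] {A : ℝ → R} (hA : Continuous A) (c : R)
    (k : ℕ) (x : ℝ) : HasDerivAt (peanoBaker A c (k + 1)) (peanoBaker A c k x * A x) x :=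
  have h : Continuous fun s => peanoBaker A c k s * A s := (continuous_peanoBaker hA c k).mul hA
  intervalIntegral.integral_hasDerivAt_right (h.intervalIntegrable _ _)
    (h.stronglyMeasurableAtFilter _ _) h.continuousAt

theorem norm_peanoBaker_le {A : ℝ → R} (hA : Continuous A) (c : R) {r K : ℝ}
    (hK : ∀ x, |x| ≤ r → ‖A x‖ ≤ K) (k : ℕ) {x : ℝ} (hx : |x| ≤ r) :
    ‖peanoBaker A c k x‖ ≤ ‖c‖ * (K ^ k * (|x| ^ k / k.factorial)) := by
  have hK0 : 0 ≤ K := (norm_nonneg _).trans (hK x hx)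
  induction k generalizing x with
  | zero => simp [peanoBaker]
  | succ k ih =>
    have hb : ∀ s ∈ uIoc (0 : ℝ) x, |s| ≤ |x| := by
      intro s hs
      rcases le_total 0 x with h | h
      · rw [uIoc_of_le h] at hs
        rw [abs_of_pos hs.1, abs_of_nonneg h]; exact hs.2
      · rw [uIoc_of_ge h] at hs
        rw [abs_of_nonpos hs.2, abs_of_nonpos h]; linarith [hs.1]
    have h1 : ‖peanoBaker A c (k + 1) x‖ ≤
        ∫ s in uIoc (0 : ℝ) x, ‖c‖ * (K ^ k * (|s - 0| ^ k / k.factorial)) * K := by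
      refine (intervalIntegral.norm_integral_le_integral_norm_uIoc).trans ?_
      refine setIntegral_mono_on ?_ ?_ measurableSet_uIoc ?_
      · exact (((continuous_peanoBaker hA c k).mul hA).norm.intervalIntegrable 0 x).def'
      · refine Continuous.intervalIntegrable ?_ 0 x |>.def'
        fun_prop
      · intro s hs
        have hsr := (hb s hs).trans hx
        rw [sub_zero]
        exact (norm_mul_le _ _).trans
          (mul_le_mul (ih hsr) (hK s hsr) (norm_nonneg _) (by positivity))
    refine h1.trans (le_of_eq ?_)
    rw [integral_mul_const, integral_const_mul, integral_const_mul, integral_div,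
      integral_pow_abs_sub_uIoc, sub_zero, Nat.factorial_succ]
    push_cast
    field_simp
    ring

/-- Linear differential equations with continuous coefficients have global solutions. -/
theorem exists_linear_solution [CompleteSpace R] {A : ℝ → R} (hA : Continuous A) (c : R) :
    ∃ F : ℝ → R, F 0 = c ∧ ∀ x, HasDerivAt F (F x * A x) x := by
  have hsum : ∀ x, Summable fun k => peanoBaker A c k x := by
    intro x
    obtain ⟨K, hK1, hK⟩ := exists_norm_le_of_continuous hA |x|
    refine Summable.of_norm_bounded ?_ fun k => norm_peanoBaker_le hA c hK k le_rfl
    refine Summable.mul_left _ ?_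
    refine (Real.summable_pow_div_factorial (K * |x|)).congr fun k => ?_
    rw [mul_pow, mul_div_assoc]
  refine ⟨fun x => ∑' k, peanoBaker A c k x, ?_, fun x => ?_⟩
  · change ∑' k, peanoBaker A c k 0 = c
    rw [tsum_eq_single 0]
    · rfl
    · intro k hk
      obtain ⟨k, rfl⟩ := Nat.exists_eq_succ_of_ne_zero hk
      simp [peanoBaker]
  -- The constant term is split off so that differentiating the rest term by term, on an interval
  -- slightly larger than `[-|x|, |x|]`, gives back the whole series times `A`.
  · have hsplit : ∀ y, ∑' k, peanoBaker A c k y = c + ∑' k, peanoBaker A c (k + 1) y :=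
      fun y => (hsum y).tsum_eq_zero_add
    set r := |x| + 1 with hr
    obtain ⟨K, hK1, hK⟩ := exists_norm_le_of_continuous hA r
    have hu : Summable fun k : ℕ => ‖c‖ * (K ^ k * (r ^ k / k.factorial)) * K := by
      refine (Summable.mul_left _ ?_).mul_right _
      refine (Real.summable_pow_div_factorial (K * r)).congr fun k => ?_
      rw [mul_pow, mul_div_assoc]
    have hxm : x ∈ Ioo (-r) r := abs_lt.1 (by rw [hr]; linarith)
    have h := hasDerivAt_tsum_of_isPreconnected (𝕜 := ℝ) hu isOpen_Ioo isPreconnected_Ioo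
      (g := fun k => peanoBaker A c (k + 1)) (g' := fun k y => peanoBaker A c k y * A y)
      (fun k y _ => hasDerivAt_peanoBaker_succ hA c k y)
      (fun k y hy => by
        have hy' : |y| ≤ r := (abs_lt.2 hy).le
        refine (norm_mul_le _ _).trans (mul_le_mul ?_ (hK y hy') (norm_nonneg _) (by positivity))
        refine (norm_peanoBaker_le hA c hK k hy').trans ?_
        gcongr) hxm ((summable_nat_add_iff 1).2 (hsum x)) hxm
    have h2 := h.const_add c
    rw [(hsum x).tsum_mul_right] at h2
    exact h2.congr_of_eventuallyEq (Eventually.of_forall hsplit)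

theorem norm_le_gronwall_right {E : Type*} [NormedAddCommGroup E] [NormedSpace ℝ E]
    {f f' : ℝ → E} {K e r : ℝ} (hK : 1 ≤ K) (he : 0 ≤ e) (hf : ∀ x, HasDerivAt f (f' x) x)
    (hb : ∀ x, 0 ≤ x → x ≤ r → ‖f' x‖ ≤ K * ‖f x‖ + e) {x : ℝ} (hx0 : 0 ≤ x) (hx : x ≤ r) :
    ‖f x‖ ≤ (‖f 0‖ + e) * Real.exp (K * x) := by
  have h := norm_le_gronwallBound_of_norm_deriv_right_le (f := f) (f' := f') (δ := ‖f 0‖)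
    (K := K) (ε := e) (a := 0) (b := r) (fun y _ => (hf y).continuousAt.continuousWithinAt)
    (fun y _ => (hf y).hasDerivWithinAt) le_rfl (fun y hy => hb y hy.1 hy.2.le) x ⟨hx0, hx⟩
  rw [gronwallBound_of_K_ne_0 (by positivity), sub_zero] at h
  have h1 : (1 : ℝ) ≤ Real.exp (K * x) := Real.one_le_exp (by positivity)
  have h2 : e / K * (Real.exp (K * x) - 1) ≤ e * Real.exp (K * x) :=
    mul_le_mul (div_le_self he hK) (by linarith) (by linarith) he
  linarith

/-- A two-sided form of Grönwall's inequality. -/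
theorem norm_le_gronwall {E : Type*} [NormedAddCommGroup E] [NormedSpace ℝ E]
    {f f' : ℝ → E} {K e r : ℝ} (hK : 1 ≤ K) (he : 0 ≤ e) (hf : ∀ x, HasDerivAt f (f' x) x)
    (hb : ∀ x, |x| ≤ r → ‖f' x‖ ≤ K * ‖f x‖ + e) {x : ℝ} (hx : |x| ≤ r) :
    ‖f x‖ ≤ (‖f 0‖ + e) * Real.exp (K * |x|) := by
  rcases le_total 0 x with h | h
  · rw [abs_of_nonneg h] at hx ⊢
    exact norm_le_gronwall_right hK he hf
      (fun y h0 hy => hb y (by rwa [abs_of_nonneg h0])) h hx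
  · rw [abs_of_nonpos h] at hx ⊢
    have h1 := norm_le_gronwall_right (f := fun y => f (-y)) (f' := fun y => -f' (-y)) hK he
      (fun y => by
        simpa [Function.comp_def] using HasDerivAt.scomp y (hf (-y)) (hasDerivAt_neg y))
      (r := r) (fun y h0 hy => by
        rw [norm_neg]
        exact hb (-y) (by rwa [abs_neg, abs_of_nonneg h0])) (x := -x) (by linarith) hx
    simpa using h1

theorem linear_solution_unique {A F G : ℝ → R} (hA : Continuous A)
    (hF : ∀ x, HasDerivAt F (F x * A x) x) (hG : ∀ x, HasDerivAt G (G x * A x) x)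
    (h0 : F 0 = G 0) : F = G := by
  funext x
  obtain ⟨K, hK1, hK⟩ := exists_norm_le_of_continuous hA |x|
  have h := norm_le_gronwall (f := F - G) (e := 0) (r := |x|) hK1 le_rfl
    (fun y => (hF y).sub (hG y)) (fun y hy => by
      rw [← sub_mul, add_zero, mul_comm K]
      exact (norm_mul_le _ _).trans (mul_le_mul_of_nonneg_left (hK y hy) (norm_nonneg _)))
    (x := x) le_rfl
  simpa [h0, sub_eq_zero] using h

end LinearSystems

end CentralAffine

namespace CentralAffine

/-! ### Compatible linear systems in two variables. -/

section Frobenius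

open Set Filter Topology

/-- A function on the plane with smooth logarithmic partial derivatives is smooth. -/
theorem contDiff_of_partials {R : Type*} [NormedRing R] [NormedAlgebra ℝ R] {A Z G : ℝ → ℝ → R}
    (hA : ContDiff ℝ ∞ fun p : ℝ × ℝ => A p.1 p.2) (hZ : ContDiff ℝ ∞ fun p : ℝ × ℝ => Z p.1 p.2)
    (hG : Continuous fun p : ℝ × ℝ => G p.1 p.2)
    (hx : ∀ x t, HasDerivAt (fun y => G y t) (G x t * A x t) x)
    (ht : ∀ x t, HasDerivAt (fun s => G x s) (G x t * Z x t) t) :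
    ContDiff ℝ ∞ fun p : ℝ × ℝ => G p.1 p.2 := by
  have hfd : ∀ p : ℝ × ℝ, HasFDerivAt (fun p : ℝ × ℝ => G p.1 p.2)
      ((ContinuousLinearMap.fst ℝ ℝ ℝ).smulRight (G p.1 p.2 * A p.1 p.2) +
        (ContinuousLinearMap.snd ℝ ℝ ℝ).smulRight (G p.1 p.2 * Z p.1 p.2)) p := by
    intro p
    have h := hasStrictFDerivAt_uncurry_coprod (𝕜 := ℝ) (u := p) (f := G)
      (f₁ := fun x t => (ContinuousLinearMap.id ℝ ℝ).smulRight (G x t * A x t))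
      (f₂ := fun x t => (ContinuousLinearMap.id ℝ ℝ).smulRight (G x t * Z x t))
      (Eventually.of_forall fun v => (hx v.1 v.2).hasFDerivAt)
      (Eventually.of_forall fun v => (ht v.1 v.2).hasFDerivAt)
      (Continuous.continuousAt (by
        change Continuous fun p : ℝ × ℝ =>
          (ContinuousLinearMap.id ℝ ℝ).smulRight (G p.1 p.2 * A p.1 p.2)
        exact ((ContinuousLinearMap.smulRightL ℝ ℝ R (.id ℝ ℝ)).continuous.comp
          (hG.mul hA.continuous))))
      (Continuous.continuousAt (by
        change Continuous fun p : ℝ × ℝ =>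
          (ContinuousLinearMap.id ℝ ℝ).smulRight (G p.1 p.2 * Z p.1 p.2)
        exact ((ContinuousLinearMap.smulRightL ℝ ℝ R (.id ℝ ℝ)).continuous.comp
          (hG.mul hZ.continuous))))
    refine h.hasFDerivAt.congr_fderiv ?_
    ext <;> simp [Function.HasUncurry.uncurry]
  -- Bootstrapping: the derivative is `G` times smooth data, so `Cⁿ` regularity of `G` yields
  -- `Cⁿ⁺¹`.
  refine contDiff_infty.2 fun n => ?_
  induction n with
  | zero => exact contDiff_zero.2 hG
  | succ n ih =>
    have hle : ((n : ℕ) : WithTop ℕ∞) ≤ ∞ := by exact_mod_cast le_top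
    push_cast
    refine contDiff_succ_iff_hasFDerivAt.2 ⟨_, ?_, hfd⟩
    exact (contDiff_const.smulRight (ih.mul (hA.of_le hle))).add
      (contDiff_const.smulRight (ih.mul (hZ.of_le hle)))

/-- The linear system `Gₓ = G A`, `Gₜ = G Z` is solvable if it satisfies the zero curvature
condition `Aₜ = Zₓ + [A, Z]`. -/
theorem exists_frobenius {R : Type*} [NormedRing R] [NormedAlgebra ℝ R] [CompleteSpace R]
    {A Z At Zx : ℝ → ℝ → R}
    (hA : ContDiff ℝ ∞ fun p : ℝ × ℝ => A p.1 p.2) (hZ : ContDiff ℝ ∞ fun p : ℝ × ℝ => Z p.1 p.2)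
    (hAt' : Continuous fun p : ℝ × ℝ => At p.1 p.2)
    (hAt : ∀ x t, HasDerivAt (fun s => A x s) (At x t) t)
    (hZx : ∀ x t, HasDerivAt (fun y => Z y t) (Zx x t) x)
    (hcomp : ∀ x t, At x t = Zx x t + (A x t * Z x t - Z x t * A x t)) (c : R) :
    ∃ G : ℝ → ℝ → R, (ContDiff ℝ ∞ fun p : ℝ × ℝ => G p.1 p.2) ∧ G 0 0 = c ∧
      (∀ x t, HasDerivAt (fun y => G y t) (G x t * A x t) x) ∧
      ∀ x t, HasDerivAt (fun s => G x s) (G x t * Z x t) t := by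
  have hAx : ∀ t, Continuous fun x => A x t := fun t =>
    hA.continuous.comp (continuous_id.prodMk continuous_const)
  -- Solve along the `t`-axis first, then along every horizontal line from the values found there.
  -- The equation in `t` away from the axis has to be deduced from zero curvature.
  obtain ⟨h, h0, hh⟩ := exists_linear_solution
    (show Continuous fun t => Z 0 t from
      hZ.continuous.comp (continuous_const.prodMk continuous_id)) c
  choose G hG0 hGx using fun t => exists_linear_solution (hAx t) (h t)
  have hbox : ∀ (F : ℝ × ℝ → R), Continuous F → ∀ r : ℝ,
      ∃ K, 1 ≤ K ∧ ∀ x t, |x| ≤ r → |t| ≤ r → ‖F (x, t)‖ ≤ K := by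
    intro F hF r
    obtain ⟨K, hK⟩ := (isCompact_Icc (a := ((-r, -r) : ℝ × ℝ)) (b := (r, r))
      ).exists_bound_of_continuousOn hF.continuousOn
    refine ⟨max K 1, le_max_right _ _, fun x t hx ht => (hK _ ?_).trans (le_max_left _ _)⟩
    exact ⟨⟨(abs_le.1 hx).1, (abs_le.1 ht).1⟩, ⟨(abs_le.1 hx).2, (abs_le.1 ht).2⟩⟩
  have hGt : ∀ x t, HasDerivAt (fun s => G s x) (G t x * Z x t) t := by
    intro x₀ t
    set r := max |x₀| (|t| + 1) with hr
    obtain ⟨K, hK1, hK⟩ := hbox _ hA.continuous r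
    obtain ⟨L, hL1, hL⟩ := hbox _ hZ.continuous r
    obtain ⟨M, hM1, hM⟩ := exists_norm_le_of_continuous
      (continuous_iff_continuousAt.2 fun x => (hGx t x).continuousAt) r
    rw [hasDerivAt_iff_isLittleO, Asymptotics.isLittleO_iff]
    intro e he
    -- The `1` accounts for the error on the `t`-axis and `2 M L` for the two source terms below;
    -- the exponential is the Grönwall factor.
    set C := (1 + 2 * (M * L)) * Real.exp (K * r) with hC
    have hC0 : 0 < C := by positivity
    obtain ⟨d, hd0, hd⟩ : ∃ d > 0, d ≤ 1 ∧ ∀ s, |s - t| < d → ∀ x, |x| ≤ r →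
        ‖A x s - A x t‖ ≤ e / C ∧ ‖At x s - At x t‖ ≤ e / C := by
      have hu : ∀ F : ℝ × ℝ → R, Continuous F → ∃ d > 0, ∀ s, |s - t| < d → |s - t| ≤ 1 →
          ∀ x, |x| ≤ r → ‖F (x, s) - F (x, t)‖ ≤ e / C := by
        intro F hF
        have := (isCompact_Icc (a := ((-r, -r) : ℝ × ℝ)) (b := (r, r))
          ).uniformContinuousOn_of_continuous hF.continuousOn
        obtain ⟨d, hd0, hd⟩ := Metric.uniformContinuousOn_iff.1 this (e / C) (by positivity)
        refine ⟨d, hd0, fun s hs hs1 x hx => ?_⟩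
        have hm : ∀ s, |s - t| ≤ 1 → (x, s) ∈ Icc ((-r, -r) : ℝ × ℝ) (r, r) := by
          intro s hs
          have hsr : |s| ≤ r := by
            have := abs_add_le (s - t) t
            rw [sub_add_cancel] at this
            have := le_max_right |x₀| (|t| + 1)
            linarith
          exact ⟨⟨(abs_le.1 hx).1, (abs_le.1 hsr).1⟩, ⟨(abs_le.1 hx).2, (abs_le.1 hsr).2⟩⟩
        have := hd _ (hm s hs1) _ (hm t (by simp)) (by simpa [Prod.dist_eq, Real.dist_eq] using hs)
        rw [dist_eq_norm] at this
        exact this.le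
      obtain ⟨d₁, h1, h1'⟩ := hu _ hA.continuous
      obtain ⟨d₂, h2, h2'⟩ := hu _ hAt'
      refine ⟨min 1 (min d₁ d₂), by positivity, min_le_left _ _, fun s hs x hx => ?_⟩
      have hs' := lt_min_iff.1 hs
      have hs'' := lt_min_iff.1 hs'.2
      exact ⟨h1' s hs''.1 hs'.1.le x hx, h2' s hs''.2 hs'.1.le x hx⟩
    have hinit : ∀ᶠ s in 𝓝 t, ‖h s - h t - (s - t) • (h t * Z 0 t)‖ ≤ e / C * ‖s - t‖ :=
      Asymptotics.isLittleO_iff.1 (hasDerivAt_iff_isLittleO.1 (hh t)) (by positivity)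
    filter_upwards [hinit, Metric.ball_mem_nhds t hd0] with s hs hsd
    rw [Metric.mem_ball, Real.dist_eq] at hsd
    rw [Real.norm_eq_abs] at hs ⊢
    have htr : |t| ≤ r := (by linarith : |t| ≤ |t| + 1).trans (le_max_right _ _)
    have hsr : |s| ≤ r := by
      have := abs_add_le (s - t) t
      rw [sub_add_cancel] at this
      have := le_max_right |x₀| (|t| + 1)
      linarith
    have hAs : ∀ x, |x| ≤ r → ‖A x s - A x t - (s - t) • At x t‖ ≤ e / C * |s - t| := by
      intro x hx
      have := Convex.norm_image_sub_le_of_norm_hasDerivWithin_le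
        (f := fun y => A x y - y • At x t) (f' := fun y => At x y - At x t) (C := e / C)
        (s := Metric.ball t d) (x := t) (y := s)
        (fun y _ => by
          have := (hAt x y).sub ((hasDerivAt_id y).smul_const (At x t))
          rw [one_smul] at this
          exact this.hasDerivWithinAt)
        (fun y hy => (hd.2 y (by simpa [Real.dist_eq] using hy) x hx).2) (convex_ball _ _)
        (Metric.mem_ball_self hd0) (by simpa [Real.dist_eq] using hsd)
      rw [Real.norm_eq_abs] at this
      refine le_trans (le_of_eq ?_) this
      rw [sub_smul]
      congr 1
      abel
    -- The first-order Taylor error of `G` in `t` satisfies a linear equation in `x`. Zero curvature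
    -- cancels everything of first order in `s - t` in its source, leaving the Taylor error of `A`
    -- and a product of `s - t` with an increment of `A`. Thus differentiability in `t` propagates
    -- from `x = 0` without assuming smooth dependence on parameters.
    have key := norm_le_gronwall
      (f := fun x => G s x - G t x - (s - t) • (G t x * Z x t))
      (f' := fun x => (G s x - G t x - (s - t) • (G t x * Z x t)) * A x s +
        (G t x * (A x s - A x t - (s - t) • At x t) +
          (s - t) • (G t x * (Z x t * (A x s - A x t)))))
      (K := K) (e := 2 * (M * L) * (e / C * |s - t|)) (r := r) hK1 (by positivity)
      (fun x => by
        have h1 := ((hGx s x).sub (hGx t x)).sub (((hGx t x).mul (hZx x t)).const_smul (s - t))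
        refine h1.congr_deriv ?_
        rw [hcomp]
        simp only [smul_sub, smul_add, mul_sub, sub_mul, mul_add, smul_mul_assoc, mul_smul_comm,
          mul_assoc]
        abel)
      (fun x hx => by
        refine (norm_add_le _ _).trans (add_le_add ?_ ((norm_add_le _ _).trans ?_))
        · rw [mul_comm K]
          exact (norm_mul_le _ _).trans
            (mul_le_mul_of_nonneg_left (hK x s hx hsr) (norm_nonneg _))
        · have e1 : ‖G t x * (A x s - A x t - (s - t) • At x t)‖ ≤ M * (e / C * |s - t|) :=
            (norm_mul_le _ _).trans
              (mul_le_mul (hM x hx) (hAs x hx) (norm_nonneg _) (by positivity))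
          have e2 : ‖(s - t) • (G t x * (Z x t * (A x s - A x t)))‖ ≤
              |s - t| * (M * (L * (e / C))) := by
            rw [norm_smul, Real.norm_eq_abs]
            refine mul_le_mul_of_nonneg_left ?_ (abs_nonneg _)
            refine (norm_mul_le _ _).trans
              (mul_le_mul (hM x hx) ?_ (norm_nonneg _) (by positivity))
            exact (norm_mul_le _ _).trans
              (mul_le_mul (hL x t hx htr) (hd.2 s hsd x hx).1 (norm_nonneg _) (by positivity))
          have e3 : M * (e / C * |s - t|) ≤ M * L * (e / C * |s - t|) := by
            refine mul_le_mul_of_nonneg_right ?_ (by positivity)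
            exact le_mul_of_one_le_right (by positivity) hL1
          have e4 : |s - t| * (M * (L * (e / C))) = M * L * (e / C * |s - t|) := by ring
          linarith)
      (x := x₀) (le_max_left _ _)
    refine key.trans ?_
    simp only [hG0]
    have hexp : Real.exp (K * |x₀|) ≤ Real.exp (K * r) := by
      gcongr
      exact le_max_left _ _
    calc _ ≤ (e / C * |s - t| + 2 * (M * L) * (e / C * |s - t|)) * Real.exp (K * r) := by
          gcongr
      _ = e / C * C * |s - t| := by rw [hC]; ring
      _ = e * |s - t| := by rw [div_mul_cancel₀ _ hC0.ne']
  -- Joint continuity: `G` is Lipschitz in `x` with a constant locally uniform in `t`, and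
  -- continuous in `t` on each vertical line.
  have hGc : Continuous fun p : ℝ × ℝ => G p.2 p.1 := by
    rw [continuous_iff_continuousAt]
    rintro ⟨x₁, t₁⟩
    set r := max |x₁| |t₁| + 1 with hr
    obtain ⟨K, hK1, hK⟩ := hbox _ hA.continuous r
    obtain ⟨M, hM1, hM⟩ := exists_norm_le_of_continuous
      (continuous_iff_continuousAt.2 fun x => (hh x).continuousAt) r
    have hb : ∀ x t, |x| ≤ r → |t| ≤ r → ‖G t x‖ ≤ M * Real.exp (K * r) := by
      intro x t hx ht
      have := norm_le_gronwall hK1 le_rfl (hGx t) (e := 0) (r := r) (fun x hx => by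
        rw [add_zero, mul_comm K]
        exact (norm_mul_le _ _).trans
          (mul_le_mul_of_nonneg_left (hK x t hx ht) (norm_nonneg _))) hx
      rw [add_zero, hG0] at this
      refine this.trans ?_
      have := hM t ht
      gcongr
    set C := M * Real.exp (K * r) * K with hC
    have hlip : ∀ x t, |x| ≤ r → |t| ≤ r → ‖G t x - G t x₁‖ ≤ C * |x - x₁| := by
      intro x t hx ht
      refine Convex.norm_image_sub_le_of_norm_hasDerivWithin_le (f := G t)
        (f' := fun x => G t x * A x t) (s := Icc (-r) r)
        (fun y _ => (hGx t y).hasDerivWithinAt)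
        (fun y hy => (norm_mul_le _ _).trans (mul_le_mul (hb y t (abs_le.2 hy) ht)
          (hK y t (abs_le.2 hy) ht) (norm_nonneg _) (by positivity))) (convex_Icc _ _)
        (abs_le.1 ?_) (abs_le.1 hx)
      linarith [le_max_left |x₁| |t₁|]
    rw [ContinuousAt, tendsto_iff_norm_sub_tendsto_zero]
    have hlim : Tendsto (fun p : ℝ × ℝ => C * |p.1 - x₁| + ‖G p.2 x₁ - G t₁ x₁‖)
        (𝓝 (x₁, t₁)) (𝓝 0) := by
      have hc : ContinuousAt (fun p : ℝ × ℝ => C * |p.1 - x₁| + ‖G p.2 x₁ - G t₁ x₁‖)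
          (x₁, t₁) := by
        have : ContinuousAt (fun p : ℝ × ℝ => G p.2 x₁) (x₁, t₁) :=
          ContinuousAt.comp (g := fun s => G s x₁) (hGt x₁ t₁).continuousAt continuousAt_snd
        exact (continuousAt_const.mul (continuousAt_fst.sub continuousAt_const).abs).add
          (this.sub continuousAt_const).norm
      simpa [ContinuousAt] using hc
    refine squeeze_zero' (Eventually.of_forall fun _ => norm_nonneg _) ?_ hlim
    filter_upwards [Metric.ball_mem_nhds (x₁, t₁) one_pos] with p hp
    rw [Metric.mem_ball, Prod.dist_eq, max_lt_iff, Real.dist_eq, Real.dist_eq] at hp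
    have hp1 := abs_add_le (p.1 - x₁) x₁
    have hp2 := abs_add_le (p.2 - t₁) t₁
    rw [sub_add_cancel] at hp1 hp2
    have := hlip p.1 p.2 (by linarith [le_max_left |x₁| |t₁|])
      (by linarith [le_max_right |x₁| |t₁|])
    have h3 := norm_add_le (G p.2 p.1 - G p.2 x₁) (G p.2 x₁ - G t₁ x₁)
    rw [sub_add_sub_cancel] at h3
    linarith
  exact ⟨fun x t => G t x, contDiff_of_partials hA hZ hGc (fun x t => hGx t x) hGt,
    (hG0 0).trans h0, fun x t => hGx t x, hGt⟩

end Frobenius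

end CentralAffine

namespace CentralAffine

/-! ### Traces of powers of a root of `λ`. -/

section LaurentTrace

variable {R : Type*} [Ring R]

/-- A product of Laurent series as a sum over a fixed finite range. -/
theorem coeff_mul_eq_sum_Icc {X Y : LaurentSeries R} {a b : ℤ} (hX : ∀ m < a, X.coeff m = 0)
    (hY : ∀ m < b, Y.coeff m = 0) (m : ℤ) :
    (X * Y).coeff m = ∑ i ∈ Finset.Icc a (m - b), X.coeff i * Y.coeff (m - i) := by
  rw [HahnSeries.coeff_mul]
  refine Finset.sum_bij_ne_zero (fun p _ _ => p.1) ?_ ?_ ?_ ?_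
  · intro p hp hne
    rw [Finset.mem_antidiagonal] at hp
    rw [Finset.mem_Icc]
    constructor
    · by_contra! h
      exact hne (by rw [hX _ h, zero_mul])
    · by_contra! h
      exact hne (by rw [hY p.2 (by linarith [hp.2.2]), mul_zero])
  · intro p hp _ q hq _ h
    rw [Finset.mem_antidiagonal] at hp hq
    exact Prod.ext h (by linarith [hp.2.2, hq.2.2])
  · intro i _ hne
    refine ⟨(i, m - i), ?_, hne, rfl⟩
    rw [Finset.mem_antidiagonal]
    refine ⟨fun h => hne (by rw [h, zero_mul]), fun h => hne (by rw [h, mul_zero]), ?_⟩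
    exact add_sub_cancel _ _
  · intro p hp _
    rw [Finset.mem_antidiagonal] at hp
    rw [← hp.2.2, add_sub_cancel_left]

/-- The Euler derivation `T d/dT` of Laurent series in `T`. -/
noncomputable def eulerD (X : LaurentSeries R) : LaurentSeries R where
  coeff m := m • X.coeff m
  isPWO_support' := X.isPWO_support.mono fun m hm h => hm (by
    change m • X.coeff m = 0
    rw [h, smul_zero])

@[simp]
theorem coeff_eulerD (X : LaurentSeries R) (m : ℤ) : (eulerD X).coeff m = m • X.coeff m := rfl

theorem support_eulerD_subset (X : LaurentSeries R) : (eulerD X).support ⊆ X.support :=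
  fun m hm h => hm (by rw [coeff_eulerD, h, smul_zero])

theorem eulerD_mul (X Y : LaurentSeries R) : eulerD (X * Y) = eulerD X * Y + X * eulerD Y := by
  ext m
  rw [coeff_eulerD, HahnSeries.coeff_add, HahnSeries.coeff_mul,
    HahnSeries.coeff_mul_left' X.isPWO_support (support_eulerD_subset X),
    HahnSeries.coeff_mul_right' Y.isPWO_support (support_eulerD_subset Y),
    ← Finset.sum_add_distrib, Finset.smul_sum]
  refine Finset.sum_congr rfl fun p hp => ?_
  rw [Finset.mem_antidiagonal] at hp
  rw [coeff_eulerD, coeff_eulerD, ← hp.2.2, add_smul, smul_mul_assoc, mul_smul_comm]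

theorem trace_coeff_mul_comm {n : ℕ} (X Y : LaurentSeries (Matrix (Fin n) (Fin n) ℝ)) (m : ℤ) :
    ((X * Y).coeff m).trace = ((Y * X).coeff m).trace := by
  rw [HahnSeries.coeff_mul, HahnSeries.coeff_mul, Matrix.trace_sum, Matrix.trace_sum]
  refine Finset.sum_bij (fun p _ => p.swap) ?_ ?_ ?_ ?_
  · intro p hp
    rw [Finset.mem_antidiagonal] at hp ⊢
    exact ⟨hp.2.1, hp.1, (add_comm _ _).trans hp.2.2⟩
  · intro p _ q _ h
    exact Prod.swap_injective h
  · intro p hp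
    refine ⟨p.swap, ?_, p.swap_swap⟩
    rw [Finset.mem_antidiagonal] at hp ⊢
    exact ⟨hp.2.1, hp.1, (add_comm _ _).trans hp.2.2⟩
  · intro p _
    exact Matrix.trace_mul_comm _ _

/-- Cyclicity of the trace and `Y W = W Y` make all terms of the Leibniz expansion of the power
equal. -/
theorem trace_coeff_eulerD_pow_mul {n : ℕ} {Y W : LaurentSeries (Matrix (Fin n) (Fin n) ℝ)}
    (h : Commute Y W) (k : ℕ) (m : ℤ) :
    ((eulerD (Y ^ (k + 1)) * W).coeff m).trace =
      (k + 1) * ((Y ^ k * eulerD Y * W).coeff m).trace := by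
  induction k generalizing W with
  | zero => simp
  | succ k ih =>
    rw [pow_succ Y (k + 1), eulerD_mul, add_mul, HahnSeries.coeff_add, Matrix.trace_add,
      mul_assoc (eulerD _), ih ((Commute.refl Y).mul_right h), h.eq, ← mul_assoc,
      trace_coeff_mul_comm _ Y, ← mul_assoc, ← mul_assoc, ← pow_succ' Y k]
    push_cast
    ring

/-- The powers of an `n`-th root of `λ` have no trace in degree zero. -/
theorem trace_coeff_zero_pow {n j : ℕ} (hn : n ≠ 0) (hj : j ≠ 0)
    {Y : LaurentSeries (Matrix (Fin n) (Fin n) ℝ)} (hY : Y ^ n = HahnSeries.single (-1) 1) :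
    ((Y ^ j).coeff 0).trace = 0 := by
  obtain ⟨k, rfl⟩ := Nat.exists_eq_succ_of_ne_zero hn
  -- The series variable is `λ⁻¹`, hence the minus sign.
  have hD : eulerD (Y ^ (k + 1)) = -Y ^ (k + 1) := by
    rw [hY]
    ext1
    funext m
    rw [coeff_eulerD, HahnSeries.coeff_neg]
    by_cases h : m = -1
    · subst h; simp
    · simp [HahnSeries.coeff_single_of_ne h]
  -- With `q` the trace of the coefficient of `λ` in `Y^{n+j-1} D Y`, the same quantity `-tr (Yʲ)₀`
  -- is computed as `n q` here and as `(n + j) q` next, which forces `q = 0`.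
  have h1 := trace_coeff_eulerD_pow_mul ((Commute.refl Y).pow_right j) k (-1)
  have h2 := trace_coeff_eulerD_pow_mul (Commute.one_right Y) (k + j) (-1)
  have hp : (Y ^ (k + 1 + j)).coeff (-1) = (Y ^ j).coeff 0 := by
    rw [pow_add, hY]
    have := HahnSeries.coeff_single_mul_add (r := 1) (x := Y ^ j) (a := 0) (b := -1)
    rw [zero_add, one_mul] at this
    exact this
  rw [hD, neg_mul, ← pow_add, HahnSeries.coeff_neg, Matrix.trace_neg, hp,
    mul_assoc, trace_coeff_mul_comm, mul_assoc, ← pow_add, trace_coeff_mul_comm] at h1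
  rw [mul_one, mul_one, add_right_comm, coeff_eulerD, hp, neg_smul, one_smul, Matrix.trace_neg,
    add_comm k j] at h2
  have hk : ((k : ℝ) + 1) * (j + k + 1) ≠ 0 := by positivity
  have hj' : (j : ℝ) ≠ 0 := by exact_mod_cast hj
  push_cast at h2
  set q := ((Y ^ (j + k) * eulerD Y).coeff (-1)).trace
  have hq : (j : ℝ) * q = 0 := by linear_combination h1 - h2
  have hq0 := (mul_eq_zero.1 hq).resolve_left hj'
  rw [hq0, mul_zero] at h1
  linarith

end LaurentTrace

/-! ### The principal grading and the cyclic matrix. -/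

section PrincipalGrading

variable {n : ℕ}

/-- The component of principal degree `d`, where `e_{ik} λᵐ` has degree `i - k + n m`. -/
def gr (d : ℤ) (X : LaurentSeries (Matrix (Fin n) (Fin n) ℝ)) : Matrix (Fin n) (Fin n) ℝ :=
  Matrix.of fun i k => if (n : ℤ) ∣ (i : ℤ) - k - d then X.coeff (((i : ℤ) - k - d) / n) i k else 0

theorem gr_apply (d : ℤ) (X : LaurentSeries (Matrix (Fin n) (Fin n) ℝ)) (i k : Fin n) :
    gr d X i k =
      if (n : ℤ) ∣ (i : ℤ) - k - d then X.coeff (((i : ℤ) - k - d) / n) i k else 0 := rfl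

/-- Every matrix entry of every coefficient lies in exactly one degree, so a series with all
components zero is zero. -/
theorem coeff_eq_gr (X : LaurentSeries (Matrix (Fin n) (Fin n) ℝ)) (a : ℤ) (i k : Fin n) :
    X.coeff a i k = gr ((i : ℤ) - k - n * a) X i k := by
  have hn : (n : ℤ) ≠ 0 := by have := i.pos; omega
  rw [gr_apply, sub_sub_cancel, if_pos (dvd_mul_right _ _), Int.mul_ediv_cancel_left _ hn]

theorem gr_sub (d : ℤ) (X Y : LaurentSeries (Matrix (Fin n) (Fin n) ℝ)) :
    gr d (X - Y) = gr d X - gr d Y := by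
  ext i k
  simp only [gr_apply, Matrix.sub_apply, HahnSeries.coeff_sub]
  split_ifs <;> simp

theorem gr_add (d : ℤ) (X Y : LaurentSeries (Matrix (Fin n) (Fin n) ℝ)) :
    gr d (X + Y) = gr d X + gr d Y := by
  ext i k
  simp only [gr_apply, Matrix.add_apply, HahnSeries.coeff_add]
  split_ifs <;> simp

theorem le_of_coeff_ne_zero {X : LaurentSeries (Matrix (Fin n) (Fin n) ℝ)} {d a : ℤ}
    {i k : Fin n} (hX : ∀ d' > d, gr d' X = 0) (h : X.coeff a i k ≠ 0) :
    (i : ℤ) - k - n * a ≤ d := by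
  by_contra! hd
  rw [coeff_eq_gr, hX _ hd] at h
  exact h rfl

theorem coeff_mul_apply (X Y : LaurentSeries (Matrix (Fin n) (Fin n) ℝ)) (m : ℤ) (i k : Fin n) :
    (X * Y).coeff m i k = ∑ l, ∑ p ∈ Finset.antidiagonal X.isPWO_support Y.isPWO_support m,
      X.coeff p.1 i l * Y.coeff p.2 l k := by
  rw [HahnSeries.coeff_mul, Finset.sum_comm, Matrix.sum_apply]
  rfl

theorem gr_mul_of_gt {X Y : LaurentSeries (Matrix (Fin n) (Fin n) ℝ)} {d e f : ℤ}
    (hX : ∀ d' > d, gr d' X = 0) (hY : ∀ e' > e, gr e' Y = 0) (hf : f > d + e) :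
    gr f (X * Y) = 0 := by
  ext i k
  rw [gr_apply]
  split_ifs with h
  · rw [coeff_mul_apply]
    refine Finset.sum_eq_zero fun l _ => Finset.sum_eq_zero fun p hp => ?_
    rw [Finset.mem_antidiagonal] at hp
    by_contra hne
    have h1 := le_of_coeff_ne_zero hX (left_ne_zero_of_mul hne)
    have h2 := le_of_coeff_ne_zero hY (right_ne_zero_of_mul hne)
    have h3 := Int.mul_ediv_cancel' h
    rw [← hp.2.2, mul_add] at h3
    linarith
  · rfl

/-- Within a fixed degree the position of an entry determines its power of `λ`, so nothing is lost
by setting `λ = 1`, and top components multiply as plain matrices. -/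
theorem gr_mul {X Y : LaurentSeries (Matrix (Fin n) (Fin n) ℝ)} {d e : ℤ}
    (hX : ∀ d' > d, gr d' X = 0) (hY : ∀ e' > e, gr e' Y = 0) :
    gr (d + e) (X * Y) = gr d X * gr e Y := by
  ext i k
  have hn : (n : ℤ) ≠ 0 := by have := i.pos; omega
  rw [gr_apply, Matrix.mul_apply]
  split_ifs with h
  · rw [coeff_mul_apply]
    have h3 := Int.mul_ediv_cancel' h
    refine Finset.sum_congr rfl fun l _ => ?_
    have hterm : ∀ p ∈ Finset.antidiagonal X.isPWO_support Y.isPWO_support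
        (((i : ℤ) - k - (d + e)) / n), X.coeff p.1 i l * Y.coeff p.2 l k ≠ 0 →
        (i : ℤ) - l - d = n * p.1 := by
      intro p hp hne
      rw [Finset.mem_antidiagonal] at hp
      have h1 := le_of_coeff_ne_zero hX (left_ne_zero_of_mul hne)
      have h2 := le_of_coeff_ne_zero hY (right_ne_zero_of_mul hne)
      rw [← hp.2.2, mul_add] at h3
      linarith
    by_cases hl : (n : ℤ) ∣ (i : ℤ) - l - d
    · obtain ⟨a, ha⟩ := hl
      have hb : (l : ℤ) - k - e = n * (((i : ℤ) - k - (d + e)) / n - a) := by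
        rw [mul_sub, h3, ← ha]; ring
      have hXa : gr d X i l = X.coeff a i l := by
        rw [coeff_eq_gr, ← ha, sub_sub_cancel]
      have hYb : gr e Y l k = Y.coeff (((i : ℤ) - k - (d + e)) / n - a) l k := by
        rw [coeff_eq_gr, ← hb, sub_sub_cancel]
      rw [hXa, hYb]
      refine Finset.sum_eq_single (a, ((i : ℤ) - k - (d + e)) / n - a) ?_ ?_
      · intro p hp hpne
        by_contra hne
        have h1 := hterm p hp hne
        rw [ha] at h1
        have h2 : p.1 = a := (mul_left_cancel₀ hn h1).symm
        rw [Finset.mem_antidiagonal] at hp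
        exact hpne (Prod.ext h2 (by simp only; rw [← hp.2.2, h2, add_sub_cancel_left]))
      · intro hnot
        rw [Finset.mem_antidiagonal] at hnot
        by_contra hne
        refine hnot ⟨fun h0 => hne ?_, fun h0 => hne ?_, add_sub_cancel _ _⟩
        · simp only at h0 ⊢; rw [h0, Matrix.zero_apply, zero_mul]
        · simp only at h0 ⊢; rw [h0, Matrix.zero_apply, mul_zero]
    · rw [gr_apply, if_neg hl, zero_mul]
      refine Finset.sum_eq_zero fun p hp => ?_
      by_contra hne
      exact hl ⟨_, hterm p hp hne⟩
  · symm
    refine Finset.sum_eq_zero fun l _ => ?_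
    rw [gr_apply, gr_apply]
    split_ifs with h1 h2
    · have h3 := dvd_add h1 h2
      rw [show (i : ℤ) - l - d + (l - k - e) = i - k - (d + e) by ring] at h3
      exact absurd h3 h
    all_goals simp

theorem gr_one_of_pos {d : ℤ} (hd : 0 < d) :
    gr d (1 : LaurentSeries (Matrix (Fin n) (Fin n) ℝ)) = 0 := by
  ext i k
  have hn : (0 : ℤ) < n := by have := i.pos; omega
  rw [gr_apply, HahnSeries.coeff_one]
  split_ifs with h h0
  · have h1 := Int.mul_ediv_cancel' h
    rw [h0, mul_zero] at h1
    have : i ≠ k := by rintro rfl; omega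
    simp [this]
  all_goals rfl

theorem gr_zero_one : gr 0 (1 : LaurentSeries (Matrix (Fin n) (Fin n) ℝ)) = 1 := by
  ext i k
  have hn : (0 : ℤ) < n := by have := i.pos; omega
  rw [gr_apply, HahnSeries.coeff_one]
  by_cases hik : i = k
  · subst hik; simp
  · rw [Matrix.one_apply_ne hik]
    split_ifs with h h0
    · have h1 := Int.mul_ediv_cancel' h
      rw [h0, mul_zero] at h1
      exact absurd (Fin.ext (by omega)) hik
    all_goals rfl

theorem gr_pow {X : LaurentSeries (Matrix (Fin n) (Fin n) ℝ)} {d : ℤ}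
    (hX : ∀ d' > d, gr d' X = 0) (k : ℕ) :
    gr (k * d) (X ^ k) = gr d X ^ k ∧ ∀ d' > k * d, gr d' (X ^ k) = 0 := by
  induction k with
  | zero =>
    rw [Nat.cast_zero, zero_mul, pow_zero, pow_zero]
    exact ⟨gr_zero_one, fun d' h => gr_one_of_pos h⟩
  | succ k ih =>
    have h : ((k + 1 : ℕ) : ℤ) * d = k * d + d := by push_cast; ring
    rw [h, pow_succ, pow_succ, gr_mul ih.2 hX, ih.1]
    exact ⟨rfl, fun d' hd' => gr_mul_of_gt ih.2 hX hd'⟩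

theorem gr_root_of_ne {d : ℤ} (hd : d ≠ n) :
    gr d (HahnSeries.single (-1) 1 : LaurentSeries (Matrix (Fin n) (Fin n) ℝ)) = 0 := by
  ext i k
  rw [gr_apply]
  split_ifs with h
  · by_cases h1 : ((i : ℤ) - k - d) / n = -1
    · have h2 := Int.mul_ediv_cancel' h
      rw [h1] at h2
      have : i ≠ k := by rintro rfl; omega
      rw [h1]
      simp [this]
    · rw [HahnSeries.coeff_single_of_ne h1]
  · rfl

/-- The cyclic permutation matrix `b + e_{1n}`. -/
def cyc (n : ℕ) : Matrix (Fin n) (Fin n) ℝ := bMat n + e1n n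

theorem cyc_apply (i k : Fin n) :
    cyc n i k = (if i.val = k.val + 1 then 1 else 0) +
      if i.val = 0 ∧ k.val + 1 = n then 1 else 0 := rfl

theorem cyc_mulVec_single {k : ℕ} (hk : k + 1 < n) :
    cyc n *ᵥ Pi.single ⟨k, by omega⟩ 1 = Pi.single ⟨k + 1, hk⟩ 1 := by
  ext i
  rw [Matrix.mulVec_single_one, Matrix.col_apply, cyc_apply, Pi.single_apply]
  simp only [Fin.ext_iff]
  rw [if_neg (by omega : ¬(i.val = 0 ∧ k + 1 = n)), add_zero]

theorem cyc_mulVec_last (h : 0 < n) :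
    cyc n *ᵥ Pi.single ⟨n - 1, by omega⟩ 1 = Pi.single ⟨0, h⟩ 1 := by
  ext i
  rw [Matrix.mulVec_single_one, Matrix.col_apply, cyc_apply, Pi.single_apply]
  simp only [Fin.ext_iff]
  have := i.isLt
  rw [if_neg (by omega : ¬(i.val = n - 1 + 1)), zero_add]
  congr 1
  simp only [eq_iff_iff]
  omega

theorem cyc_pow_mulVec {k : ℕ} (hk : k < n) :
    cyc n ^ k *ᵥ Pi.single ⟨0, by omega⟩ 1 = Pi.single ⟨k, hk⟩ 1 := by
  induction k with
  | zero => rw [pow_zero, Matrix.one_mulVec]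
  | succ k ih =>
    rw [pow_succ', ← Matrix.mulVec_mulVec, ih (by omega), cyc_mulVec_single hk]

/-- The first basis vector is cyclic for `cyc n`, so an element of the centralizer is determined by
its value there. -/
theorem eq_zero_of_commute_cyc (h : 0 < n) {M : Matrix (Fin n) (Fin n) ℝ}
    (hM : Commute (cyc n) M) (h0 : M *ᵥ Pi.single ⟨0, h⟩ 1 = 0) : M = 0 := by
  refine Matrix.ext_of_mulVec_single fun k => ?_
  rw [← cyc_pow_mulVec k.isLt, Matrix.mulVec_mulVec, ← (hM.pow_left k).eq,
    ← Matrix.mulVec_mulVec, h0, Matrix.mulVec_zero, Matrix.zero_mulVec]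

theorem cyc_pow_card : cyc n ^ n = 1 := by
  rcases Nat.eq_zero_or_pos n with rfl | h
  · exact Subsingleton.elim _ _
  rw [← sub_eq_zero]
  refine eq_zero_of_commute_cyc h (((Commute.refl _).pow_right n).sub_right (Commute.one_right _))
    ?_
  obtain ⟨m, rfl⟩ := Nat.exists_eq_succ_of_ne_zero h.ne'
  rw [Matrix.sub_mulVec, Matrix.one_mulVec, pow_succ', ← Matrix.mulVec_mulVec,
    cyc_pow_mulVec (Nat.lt_succ_self m), sub_eq_zero]
  exact cyc_mulVec_last h

/-- Homogeneity leaves one possibly nonzero entry in the first column, in row `d mod n` counted from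
zero; a multiple of a power of `cyc n` has the same first column. -/
theorem exists_eq_smul_cyc_pow (h : 0 < n) {M : Matrix (Fin n) (Fin n) ℝ}
    (hM : Commute (cyc n) M) {d : ℤ} (hd : ∀ i k : Fin n, ¬(n : ℤ) ∣ (i : ℤ) - k - d → M i k = 0) :
    ∃ c : ℝ, M = c • cyc n ^ (d % n).toNat := by
  have hpos : (0 : ℤ) < n := by exact_mod_cast h
  have hr0 := Int.emod_nonneg d hpos.ne'
  have hr1 := Int.emod_lt_of_pos d hpos
  have hr : (d % n).toNat < n := by omega
  refine ⟨M ⟨_, hr⟩ ⟨0, h⟩, ?_⟩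
  rw [← sub_eq_zero]
  refine eq_zero_of_commute_cyc h (hM.sub_right (((Commute.refl _).pow_right _).smul_right _)) ?_
  rw [Matrix.sub_mulVec, Matrix.smul_mulVec, cyc_pow_mulVec hr, sub_eq_zero]
  ext i
  rw [Matrix.mulVec_single_one, Matrix.col_apply, Pi.smul_apply, Pi.single_apply]
  split_ifs with hi
  · rw [hi, smul_eq_mul, mul_one]
  · rw [smul_zero]
    refine hd _ _ fun ⟨q, hq⟩ => hi (Fin.ext ?_)
    have := i.isLt
    have hdi : d % n = (i : ℤ) % n := by
      rw [show d = (i : ℤ) + n * (-q) by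
        simp only [Nat.cast_zero, sub_zero] at hq; linarith, Int.add_mul_emod_self_left]
    rw [Int.emod_eq_of_lt (a := (i : ℤ)) (by omega) (by omega)] at hdi
    simp only [hdi, Int.toNat_natCast]

/-- `J` is homogeneous of degree `1`, while `e_{in}` with `i < n` has negative degree. -/
theorem gr_laxSeries_one (hn : 2 ≤ n) (v : Fin (n - 1) → ℝ) : gr 1 (laxSeries n v) = cyc n := by
  ext i k
  have hi := i.isLt
  have hk := k.isLt
  rw [gr_apply, cyc_apply, laxSeries, HahnSeries.coeff_add]
  split_ifs with h h1 h2 h2 h1 h2 h2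
  all_goals try omega
  · rw [show ((i : ℤ) - k - 1) / n = 0 by rw [h1]; simp]
    simp only [HahnSeries.coeff_single_same]
    rw [HahnSeries.coeff_single_of_ne (by norm_num)]
    simp [bMat, toV, h1]
    omega
  · rw [show ((i : ℤ) - k - 1) / n = -1 by
      rw [show (i : ℤ) - k - 1 = n * (-1) by omega, Int.mul_ediv_cancel_left _ (by omega)]]
    rw [HahnSeries.coeff_single_same, HahnSeries.coeff_single_of_ne (by norm_num)]
    simp [e1n, h2]
  · obtain ⟨q, hq⟩ := h
    exfalso
    have : q = 0 ∨ q = -1 ∨ 1 ≤ q ∨ q ≤ -2 := by omega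
    rcases this with rfl | rfl | h | h
    · omega
    · omega
    · nlinarith
    · nlinarith
  · refine absurd ?_ h
    rw [h1]; simp
  · refine absurd ?_ h
    exact ⟨-1, by omega⟩
  · simp

theorem gr_laxSeries_of_gt (v : Fin (n - 1) → ℝ) {d : ℤ} (hd : d > 1) :
    gr d (laxSeries n v) = 0 := by
  ext i k
  have hi := i.isLt
  have hk := k.isLt
  rw [gr_apply, laxSeries, HahnSeries.coeff_add]
  split_ifs with h
  · have h3 := Int.mul_ediv_cancel' h
    by_cases h0 : ((i : ℤ) - k - d) / n = 0
    · rw [h0, mul_zero] at h3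
      rw [h0, HahnSeries.coeff_single_same, HahnSeries.coeff_single_of_ne (by norm_num)]
      have : ¬ i.val = k.val + 1 := by omega
      simp [bMat, toV, this]
      intros
      omega
    · by_cases h1 : ((i : ℤ) - k - d) / n = -1
      · rw [h1] at h3
        rw [h1, HahnSeries.coeff_single_same, HahnSeries.coeff_single_of_ne (by norm_num)]
        simp [e1n]
        omega
      · rw [HahnSeries.coeff_single_of_ne h0, HahnSeries.coeff_single_of_ne h1, add_zero]
  · rfl

/-- Downward induction on degrees, started where boundedness above gives the claim and continuing
without end. -/
theorem int_descent {P : ℤ → Prop} {B : ℤ} (hB : ∀ d > B, P d)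
    (step : ∀ d, (∀ d' > d, P d') → P d) (d : ℤ) : P d := by
  have h : ∀ N : ℕ, ∀ d > B - N, P d := by
    intro N
    induction N with
    | zero => simpa using hB
    | succ N ih =>
      intro d hd
      push_cast at hd
      exact step d fun d' hd' => ih d' (by omega)
  exact h (B - d + 1).toNat d (by omega)

end PrincipalGrading

end CentralAffine

namespace CentralAffine

/-! ### Smooth matrix-valued functions. -/

section SmoothMatrices

variable {n : ℕ}

theorem SmoothMat.slice_fst {F : ℝ → ℝ → Matrix (Fin n) (Fin n) ℝ} (hF : SmoothMat F) (t : ℝ)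
    (i k : Fin n) : ContDiff ℝ ∞ fun y => F y t i k :=
  (hF i k).comp (contDiff_id.prodMk contDiff_const)

theorem SmoothMat.slice_snd {F : ℝ → ℝ → Matrix (Fin n) (Fin n) ℝ} (hF : SmoothMat F) (x : ℝ)
    (i k : Fin n) : ContDiff ℝ ∞ fun s => F x s i k :=
  (hF i k).comp (contDiff_const.prodMk contDiff_id)

theorem SmoothMat.hasDerivAt_fst {F : ℝ → ℝ → Matrix (Fin n) (Fin n) ℝ} (hF : SmoothMat F)
    (x t : ℝ) (i k : Fin n) : HasDerivAt (fun y => F y t i k) (dx F x t i k) x :=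
  ((hF.slice_fst t i k).differentiable (by simp) x).hasDerivAt

theorem SmoothMat.hasDerivAt_snd {F : ℝ → ℝ → Matrix (Fin n) (Fin n) ℝ} (hF : SmoothMat F)
    (x t : ℝ) (i k : Fin n) : HasDerivAt (fun s => F x s i k) (dt F x t i k) t :=
  ((hF.slice_snd x i k).differentiable (by simp) t).hasDerivAt

theorem SmoothMat.mul {F G : ℝ → ℝ → Matrix (Fin n) (Fin n) ℝ} (hF : SmoothMat F)
    (hG : SmoothMat G) : SmoothMat fun x t => F x t * G x t := fun i k => by
  simp only [Matrix.mul_apply]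
  exact ContDiff.sum fun l _ => (hF i l).mul (hG l k)

theorem SmoothMat.add {F G : ℝ → ℝ → Matrix (Fin n) (Fin n) ℝ} (hF : SmoothMat F)
    (hG : SmoothMat G) : SmoothMat fun x t => F x t + G x t := fun i k => (hF i k).add (hG i k)

theorem SmoothMat.sub {F G : ℝ → ℝ → Matrix (Fin n) (Fin n) ℝ} (hF : SmoothMat F)
    (hG : SmoothMat G) : SmoothMat fun x t => F x t - G x t := fun i k => (hF i k).sub (hG i k)

theorem SmoothMat.const (M : Matrix (Fin n) (Fin n) ℝ) : SmoothMat fun _ _ => M :=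
  fun _ _ => contDiff_const

theorem SmoothMat.sum {ι : Type*} {s : Finset ι} {F : ι → ℝ → ℝ → Matrix (Fin n) (Fin n) ℝ}
    (hF : ∀ a ∈ s, SmoothMat (F a)) : SmoothMat fun x t => ∑ a ∈ s, F a x t := fun i k => by
  simp only [Matrix.sum_apply]
  exact ContDiff.sum fun a ha => hF a ha i k

theorem dx_sub {F G : ℝ → ℝ → Matrix (Fin n) (Fin n) ℝ} (hF : SmoothMat F)
    (hG : SmoothMat G) (x t : ℝ) : dx (fun x t => F x t - G x t) x t = dx F x t - dx G x t := by
  ext i k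
  exact ((hF.hasDerivAt_fst x t i k).sub (hG.hasDerivAt_fst x t i k)).deriv

theorem dx_mul {F G : ℝ → ℝ → Matrix (Fin n) (Fin n) ℝ} (hF : SmoothMat F)
    (hG : SmoothMat G) (x t : ℝ) :
    dx (fun x t => F x t * G x t) x t = dx F x t * G x t + F x t * dx G x t := by
  ext i k
  simp only [dx, Matrix.of_apply, Matrix.mul_apply, Matrix.add_apply]
  rw [← Finset.sum_add_distrib]
  exact (HasDerivAt.fun_sum fun l _ =>
    (hF.hasDerivAt_fst x t i l).mul (hG.hasDerivAt_fst x t l k)).deriv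

theorem dt_mul {F G : ℝ → ℝ → Matrix (Fin n) (Fin n) ℝ} (hF : SmoothMat F)
    (hG : SmoothMat G) (x t : ℝ) :
    dt (fun x t => F x t * G x t) x t = dt F x t * G x t + F x t * dt G x t := by
  ext i k
  simp only [dt, Matrix.of_apply, Matrix.mul_apply, Matrix.add_apply]
  rw [← Finset.sum_add_distrib]
  exact (HasDerivAt.fun_sum fun l _ =>
    (hF.hasDerivAt_snd x t i l).mul (hG.hasDerivAt_snd x t l k)).deriv

end SmoothMatrices

/-! ### Uniqueness of `Y` and `Z`. -/

section Uniqueness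

variable {n : ℕ} {u : ℝ → ℝ → Fin (n - 1) → ℝ}

/-- The `x`-derivative does not raise the degree, so in degree `d + 1` the equation reduces to the
commutator of the top parts. -/
theorem commute_gr_of_commute (hn : 2 ≤ n)
    {Δ : ℝ → ℝ → LaurentSeries (Matrix (Fin n) (Fin n) ℝ)}
    (hΔ : ∀ (x t : ℝ) (m : ℤ), dx (fun y s => (Δ y s).coeff m) x t +
      (laxSeries n (u x t) * Δ x t - Δ x t * laxSeries n (u x t)).coeff m = 0)
    {d : ℤ} (hd : ∀ d' > d, ∀ x t, gr d' (Δ x t) = 0) (x t : ℝ) :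
    Commute (cyc n) (gr d (Δ x t)) := by
  have h0 : gr (1 + d) (laxSeries n (u x t) * Δ x t - Δ x t * laxSeries n (u x t)) = 0 := by
    ext i k
    rw [gr_apply]
    split_ifs with h
    · have h1 := congrFun (congrFun (hΔ x t (((i : ℤ) - k - (1 + d)) / n)) i) k
      have h2 : (fun y => (Δ y t).coeff (((i : ℤ) - k - (1 + d)) / n) i k) = fun _ => 0 := by
        funext y
        rw [coeff_eq_gr, Int.mul_ediv_cancel' h, sub_sub_cancel, hd _ (by omega)]
        rfl
      rw [Matrix.add_apply, dx, Matrix.of_apply, h2, deriv_const, zero_add] at h1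
      exact h1
    · rfl
  have hl := fun d' (h : d' > (1 : ℤ)) => gr_laxSeries_of_gt (u x t) h
  have hd' := fun d' (h : d' > d) => hd d' h x t
  rw [gr_sub, gr_mul hl hd', add_comm, gr_mul hd' hl, gr_laxSeries_one hn, sub_eq_zero] at h0
  exact h0

theorem IsLaxRoot.gr_eq {Y : ℝ → ℝ → LaurentSeries (Matrix (Fin n) (Fin n) ℝ)} (hn : 2 ≤ n)
    (hY : IsLaxRoot u Y) :
    (∀ d > 1, ∀ x t, gr d (Y x t) = 0) ∧ ∀ x t, gr 1 (Y x t) = cyc n := by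
  have hn0 : 0 < n := by omega
  have : Nonempty (Fin n) := ⟨⟨0, hn0⟩⟩
  have hhom : ∀ d x t, ∀ i k : Fin n, ¬(n : ℤ) ∣ (i : ℤ) - k - d → gr d (Y x t) i k = 0 :=
    fun d x t i k h => by rw [gr_apply, if_neg h]
  have hbig : ∀ d > (1 : ℤ), ∀ x t, gr d (Y x t) = 0 := by
    -- An entry of degree above `2n` carries a power of `λ` above the first, where `Y` has no
    -- coefficient.
    refine int_descent (B := 2 * n) (P := fun d => d > 1 → ∀ x t, gr d (Y x t) = 0) ?_ ?_
    · intro d hd _ x t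
      ext i k
      have hi := i.isLt
      rw [gr_apply]
      split_ifs with h
      · rw [hY.coeff_eq_zero _ _ _ ?_, Matrix.zero_apply]
        have := Int.mul_ediv_cancel' h
        nlinarith
      · rfl
    · intro d ih hd x t
      have hd' : ∀ d' > d, ∀ x t, gr d' (Y x t) = 0 := fun d' h => ih d' h (by omega)
      have hcomm := commute_gr_of_commute hn hY.commute hd' x t
      obtain ⟨c, hc⟩ := exists_eq_smul_cyc_pow hn0 hcomm (hhom d x t)
      -- The top part is `c` times a power of `cyc n`, so its `n`-th power is `cⁿ`. It must be the
      -- degree `n d` part of `λ`, which is zero for `d > 1`; hence `c = 0`.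
      have hp := (gr_pow (fun d' h => hd' d' h x t) n).1
      rw [hY.pow_eq, gr_root_of_ne (by nlinarith), hc, smul_pow, ← pow_mul, mul_comm _ n, pow_mul,
        cyc_pow_card, one_pow] at hp
      have hc0 : c ^ n = 0 := by
        have := congrFun (congrFun hp ⟨0, hn0⟩) ⟨0, hn0⟩
        simpa using this.symm
      rw [hc, pow_eq_zero_iff hn0.ne' |>.1 hc0, zero_smul]
  refine ⟨hbig, fun x t => ?_⟩
  obtain ⟨c, hc⟩ := exists_eq_smul_cyc_pow hn0
    (commute_gr_of_commute hn hY.commute hbig x t) (hhom 1 x t)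
  rw [Int.emod_eq_of_lt (by norm_num) (by omega), Int.toNat_one, pow_one] at hc
  -- The corner entry in degree `1` is that of the coefficient of `λ`; the normalization of the
  -- leading term gives `c = 1`.
  have h1 := congrFun (congrFun hc ⟨0, hn0⟩) ⟨n - 1, by omega⟩
  have hq : (((0 : ℕ) : ℤ) - ((n - 1 : ℕ) : ℤ) - 1) = n * (-1) := by omega
  rw [gr_apply, hq, if_pos (dvd_mul_right _ _), Int.mul_ediv_cancel_left _ (by omega),
    hY.leading, Matrix.smul_apply, cyc_apply] at h1
  have hn1 : n - 1 + 1 = n := by omega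
  simp [e1n, hn1, hn0.ne] at h1
  rw [hc, ← h1, one_smul]

/-- In the telescoping sum of `X^i (X - Y) Y^{k-i}` all `k + 1` top parts coincide, as the top part
of `X - Y` commutes with `cyc n`; they cannot cancel. -/
theorem gr_pow_sub_pow {X Y : LaurentSeries (Matrix (Fin n) (Fin n) ℝ)} {e : ℤ}
    (hX : ∀ d > 1, gr d X = 0) (hX1 : gr 1 X = cyc n) (hY : ∀ d > 1, gr d Y = 0)
    (hY1 : gr 1 Y = cyc n) (hXY : ∀ d > e, gr d (X - Y) = 0)
    (hcomm : Commute (cyc n) (gr e (X - Y))) (k : ℕ) :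
    gr (k + e) (X ^ (k + 1) - Y ^ (k + 1)) = ((k : ℝ) + 1) • (cyc n ^ k * gr e (X - Y)) ∧
      ∀ d > k + e, gr d (X ^ (k + 1) - Y ^ (k + 1)) = 0 := by
  induction k with
  | zero => simpa using hXY
  | succ k ih =>
    have hs : X ^ (k + 1 + 1) - Y ^ (k + 1 + 1) =
        X ^ (k + 1) * (X - Y) + (X ^ (k + 1) - Y ^ (k + 1)) * Y := by
      rw [pow_succ X, pow_succ Y, mul_sub, sub_mul, sub_add_sub_cancel]
    have hp := gr_pow hX (k + 1)
    rw [mul_one, hX1] at hp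
    have e1 : ((k + 1 : ℕ) : ℤ) + e = k + e + 1 := by push_cast; ring
    rw [hs]
    refine ⟨?_, fun d hd => ?_⟩
    · rw [gr_add, gr_mul hp.2 hXY, hp.1, e1, gr_mul ih.2 hY, ih.1, hY1, smul_mul_assoc, mul_assoc,
        ← hcomm.eq, ← mul_assoc, ← pow_succ]
      push_cast
      module
    · rw [gr_add, gr_mul_of_gt hp.2 hXY hd, gr_mul_of_gt ih.2 hY (e1 ▸ hd), add_zero]

/-- The difference satisfies the same linear equation, so its top part commutes with `cyc n`. Since
the `n`-th powers agree, `n` times an invertible matrix times that top part is zero. -/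
theorem IsLaxRoot.unique (hn : 2 ≤ n) {X Y : ℝ → ℝ → LaurentSeries (Matrix (Fin n) (Fin n) ℝ)}
    (hX : IsLaxRoot u X) (hY : IsLaxRoot u Y) : X = Y := by
  have hΔ : ∀ (x t : ℝ) (m : ℤ), dx (fun y s => (X y s - Y y s).coeff m) x t +
      (laxSeries n (u x t) * (X x t - Y x t) - (X x t - Y x t) * laxSeries n (u x t)).coeff m
        = 0 := by
    intro x t m
    have h1 := hX.commute x t m
    have h2 := hY.commute x t m
    have h3 : dx (fun y s => (X y s - Y y s).coeff m) x t =
        dx (fun y s => (X y s).coeff m) x t - dx (fun y s => (Y y s).coeff m) x t :=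
      dx_sub (hX.smooth m) (hY.smooth m) x t
    rw [h3]
    simp only [mul_sub, sub_mul, HahnSeries.coeff_sub] at h1 h2 ⊢
    rw [← sub_eq_zero.2 (h1.trans h2.symm)]
    abel
  obtain ⟨hXb, hX1⟩ := hX.gr_eq hn
  obtain ⟨hYb, hY1⟩ := hY.gr_eq hn
  have hall : ∀ d, ∀ x t, gr d (X x t - Y x t) = 0 := by
    refine int_descent (B := 0) ?_ ?_
    · intro d hd x t
      rcases (by omega : d = 1 ∨ d > 1) with rfl | h
      · rw [gr_sub, hX1, hY1, sub_self]
      · rw [gr_sub, hXb d h, hYb d h, sub_self]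
    · intro d ih x t
      have hcomm := commute_gr_of_commute hn hΔ ih x t
      obtain ⟨k, rfl⟩ : ∃ k, n = k + 1 := ⟨n - 1, by omega⟩
      have h := (gr_pow_sub_pow (fun d h => hXb d h x t) (hX1 x t) (fun d h => hYb d h x t)
        (hY1 x t) (fun d h => ih d h x t) hcomm k).1
      rw [hX.pow_eq, hY.pow_eq, gr_sub, sub_self] at h
      have h2 := (smul_eq_zero.1 h.symm).resolve_left (by positivity)
      have h3 := congrArg (cyc (k + 1) * ·) h2
      simp only [← mul_assoc, ← pow_succ', mul_zero] at h3
      rwa [cyc_pow_card, one_mul] at h3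
  funext x t
  rw [← sub_eq_zero]
  ext a i k
  rw [coeff_eq_gr, hall]
  rfl

theorem bracket_sub {C C' : ℝ → ℝ → Matrix (Fin n) (Fin n) ℝ} (hC : SmoothMat C)
    (hC' : SmoothMat C') (x t : ℝ) :
    bracket u (fun x t => C x t - C' x t) x t = bracket u C x t - bracket u C' x t := by
  rw [bracket, bracket, bracket, dx_sub hC hC', mul_sub, sub_mul]
  abel

theorem toV_sub (v w : Fin (n - 1) → ℝ) : toV n (v - w) = toV n v - toV n w := by
  ext i k
  simp only [toV, Matrix.of_apply, Matrix.sub_apply, Pi.sub_apply]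
  split_ifs <;> simp

theorem bMat_add_toV_apply_of_lt (v : Fin (n - 1) → ℝ) (i k : Fin n) (hk : k.val + 1 < n) :
    (bMat n + toV n v) i k = if i.val = k.val + 1 then 1 else 0 := by
  simp [bMat, toV, hk.ne]

theorem mul_bMat_add_toV_apply (M : Matrix (Fin n) (Fin n) ℝ) (v : Fin (n - 1) → ℝ)
    (i : Fin n) {k : ℕ} (hk : k + 1 < n) :
    (M * (bMat n + toV n v)) i ⟨k, (Nat.lt_succ_self k).trans hk⟩ = M i ⟨k + 1, hk⟩ := by
  rw [Matrix.mul_apply, Finset.sum_eq_single ⟨k + 1, hk⟩]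
  · rw [bMat_add_toV_apply_of_lt _ _ _ hk, if_pos rfl, mul_one]
  · intro l _ hl
    rw [bMat_add_toV_apply_of_lt _ _ _ hk, if_neg fun h => hl (Fin.ext h), mul_zero]
  · exact fun h => absurd (Finset.mem_univ _) h

/-- A matrix-valued function with `[∂ₓ + b + u, C]` in `Vₙ` is determined by its first column. -/
theorem eq_zero_of_bracket_mem {C : ℝ → ℝ → Matrix (Fin n) (Fin n) ℝ}
    (h0 : ∀ x t i k, k.val = 0 → C x t i k = 0) (hV : ∀ x t, ∃ v, bracket u C x t = toV n v)
    (x t : ℝ) : C x t = 0 := by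
  have h : ∀ k : ℕ, ∀ hk : k < n, ∀ x t i, C x t i ⟨k, hk⟩ = 0 := by
    intro k
    induction k with
    | zero => exact fun hk x t i => h0 x t i _ rfl
    | succ k ih =>
      intro hk x t i
      obtain ⟨v, hv⟩ := hV x t
      -- Elements of `Vₙ` vanish outside the last column. Once column `k` of `C` is identically
      -- zero, what remains of column `k` of the bracket is minus column `k + 1` of `C`.
      have h1 := congrFun (congrFun hv i) ⟨k, by omega⟩
      rw [bracket, Matrix.add_apply, Matrix.sub_apply, mul_bMat_add_toV_apply _ _ _ hk,
        Matrix.mul_apply, dx, Matrix.of_apply] at h1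
      simp only [ih] at h1
      simpa [toV, hk.ne] using h1
  ext i k
  exact h k k.isLt x t i

theorem eq_of_bracket_mem {C C' : ℝ → ℝ → Matrix (Fin n) (Fin n) ℝ} (hC : SmoothMat C)
    (hC' : SmoothMat C') (h0 : ∀ x t i k, k.val = 0 → C x t i k = C' x t i k)
    (hV : ∀ x t, ∃ v, bracket u C x t = toV n v) (hV' : ∀ x t, ∃ v, bracket u C' x t = toV n v) :
    C = C' := by
  funext x t
  rw [← sub_eq_zero]
  refine eq_zero_of_bracket_mem (u := u) (C := fun x t => C x t - C' x t)
    (fun x t i k hk => sub_eq_zero.2 (h0 x t i k hk)) (fun x t => ?_) x t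
  obtain ⟨v, hv⟩ := hV x t
  obtain ⟨w, hw⟩ := hV' x t
  exact ⟨v - w, by rw [bracket_sub hC hC', hv, hw, toV_sub]⟩

/-- The supports entering the product formula vary with `(x, t)`; uniform lower bounds turn each
coefficient into a sum over one fixed finite range. -/
theorem smooth_coeff_mul {X Y : ℝ → ℝ → LaurentSeries (Matrix (Fin n) (Fin n) ℝ)} {a b : ℤ}
    (hXb : ∀ x t, ∀ m < a, (X x t).coeff m = 0) (hX : ∀ m, SmoothMat fun x t => (X x t).coeff m)
    (hYb : ∀ x t, ∀ m < b, (Y x t).coeff m = 0) (hY : ∀ m, SmoothMat fun x t => (Y x t).coeff m) :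
    (∀ x t, ∀ m < a + b, (X x t * Y x t).coeff m = 0) ∧
      ∀ m, SmoothMat fun x t => (X x t * Y x t).coeff m := by
  refine ⟨fun x t m hm => ?_, fun m => ?_⟩
  · rw [coeff_mul_eq_sum_Icc (hXb x t) (hYb x t), Finset.Icc_eq_empty (by omega), Finset.sum_empty]
  · simp only [coeff_mul_eq_sum_Icc (hXb _ _) (hYb _ _)]
    exact SmoothMat.sum fun i _ => (hX i).mul (hY _)

theorem IsLaxRoot.smooth_pow {Y : ℝ → ℝ → LaurentSeries (Matrix (Fin n) (Fin n) ℝ)}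
    (hY : IsLaxRoot u Y) (k : ℕ) (m : ℤ) : SmoothMat fun x t => (Y x t ^ k).coeff m := by
  suffices h : ∃ a : ℤ, (∀ x t, ∀ m < a, (Y x t ^ k).coeff m = 0) ∧
      ∀ m, SmoothMat fun x t => (Y x t ^ k).coeff m from h.choose_spec.2 m
  induction k with
  | zero =>
    refine ⟨0, fun x t m hm => ?_, fun m => ?_⟩
    · rw [pow_zero, HahnSeries.coeff_one, if_neg hm.ne]
    · simp only [pow_zero]
      exact SmoothMat.const _
  | succ k ih =>
    obtain ⟨a, h1, h2⟩ := ih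
    simp only [pow_succ]
    exact ⟨a + -1, smooth_coeff_mul h1 h2 hY.coeff_eq_zero hY.smooth⟩

variable {j : ℕ} {Z Z' : ℝ → ℝ → Matrix (Fin n) (Fin n) ℝ}

theorem IsZ.smooth (hZ : IsZ j u Z) : SmoothMat Z := by
  obtain ⟨Y, ζ, hY, hζ, -, hZ, -⟩ := hZ
  obtain rfl : Z = fun x t => (Y x t ^ j).coeff 0 - ζ x t := by funext x t; exact hZ x t
  exact (hY.smooth_pow j 0).sub hζ

theorem IsZ.bracket_mem (hZ : IsZ j u Z) (x t : ℝ) : ∃ v, bracket u Z x t = toV n v := by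
  obtain ⟨-, -, -, -, -, -, h⟩ := hZ
  exact h x t

theorem IsZ.trace_eq_zero (hn : n ≠ 0) (hj : j ≠ 0) (hZ : IsZ j u Z) (x t : ℝ) :
    (Z x t).trace = 0 := by
  obtain ⟨Y, ζ, hY, -, hup, hZ, -⟩ := hZ
  rw [hZ, Matrix.trace_sub, trace_coeff_zero_pow hn hj (hY.pow_eq x t), zero_sub, neg_eq_zero]
  exact Finset.sum_eq_zero fun i _ => hup x t i i le_rfl

/-- Strict upper triangularity of `ζ` fixes the first column of `Z` as that of `Y_{j,0}`, and the
bracket condition fixes the others. -/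
theorem IsZ.unique (hn : 2 ≤ n) (hZ : IsZ j u Z) (hZ' : IsZ j u Z') : Z = Z' := by
  refine eq_of_bracket_mem (u := u) hZ.smooth hZ'.smooth ?_ hZ.bracket_mem hZ'.bracket_mem
  obtain ⟨Y, ζ, hY, -, hup, h, -⟩ := hZ
  obtain ⟨Y', ζ', hY', -, hup', h', -⟩ := hZ'
  obtain rfl := hY.unique hn hY'
  intro x t i k hk
  have hki : k ≤ i := Fin.mk_le_of_le_val (by simp [hk])
  rw [h, h', Matrix.sub_apply, Matrix.sub_apply, hup x t i k hki, hup' x t i k hki]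

end Uniqueness

end CentralAffine

namespace CentralAffine

/-! ### Matrix calculus, Liouville's formula, and zero curvature frames. -/

section MatrixCalculus

attribute [local instance] Matrix.linftyOpNormedRing Matrix.linftyOpNormedAlgebra

variable {n : ℕ}

theorem eq_sum_smul_single (M : Matrix (Fin n) (Fin n) ℝ) :
    M = ∑ i, ∑ k, M i k • Matrix.single i k (1 : ℝ) := by
  conv_lhs => rw [Matrix.matrix_eq_sum_single M]
  simp

theorem hasDerivAt_matrix_iff {F : ℝ → Matrix (Fin n) (Fin n) ℝ} {F' : Matrix (Fin n) (Fin n) ℝ}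
    {x : ℝ} : HasDerivAt F F' x ↔ ∀ i k, HasDerivAt (fun y => F y i k) (F' i k) x := by
  constructor
  · intro h i k
    exact (Matrix.entryLinearMap ℝ ℝ i k).toContinuousLinearMap.hasFDerivAt.comp_hasDerivAt x h
  · intro h
    rw [show F = fun y => ∑ i, ∑ k, F y i k • Matrix.single i k (1 : ℝ) from
      funext fun y => eq_sum_smul_single (F y), eq_sum_smul_single F']
    exact HasDerivAt.fun_sum fun i _ => HasDerivAt.fun_sum fun k _ => (h i k).smul_const _

theorem smoothMat_iff {F : ℝ → ℝ → Matrix (Fin n) (Fin n) ℝ} :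
    SmoothMat F ↔ ContDiff ℝ ∞ fun p : ℝ × ℝ => F p.1 p.2 := by
  constructor
  · intro h
    rw [show (fun p : ℝ × ℝ => F p.1 p.2) =
      fun p => ∑ i, ∑ k, F p.1 p.2 i k • Matrix.single i k (1 : ℝ) from
      funext fun p => eq_sum_smul_single (F p.1 p.2)]
    exact ContDiff.sum fun i _ => ContDiff.sum fun k _ => (h i k).smul contDiff_const
  · intro h i k
    exact (Matrix.entryLinearMap ℝ ℝ i k).toContinuousLinearMap.contDiff.comp h

theorem contDiff_slice_snd {f : ℝ → ℝ → ℝ} (hf : ContDiff ℝ ∞ fun p : ℝ × ℝ => f p.1 p.2)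
    (x : ℝ) : ContDiff ℝ ∞ fun s => f x s :=
  hf.comp (contDiff_const.prodMk contDiff_id)

theorem deriv_fst_eq_fderiv {f : ℝ → ℝ → ℝ} (hf : ContDiff ℝ ∞ fun p : ℝ × ℝ => f p.1 p.2)
    (x t : ℝ) :
    deriv (fun y => f y t) x = fderiv ℝ (fun p : ℝ × ℝ => f p.1 p.2) (x, t) (1, 0) := by
  have h := (hf.differentiable (by simp) (x, t)).hasFDerivAt.comp_hasDerivAt x
    ((hasDerivAt_id x).prodMk (hasDerivAt_const x t))
  exact h.deriv

theorem deriv_snd_eq_fderiv {f : ℝ → ℝ → ℝ} (hf : ContDiff ℝ ∞ fun p : ℝ × ℝ => f p.1 p.2)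
    (x t : ℝ) :
    deriv (fun s => f x s) t = fderiv ℝ (fun p : ℝ × ℝ => f p.1 p.2) (x, t) (0, 1) := by
  have h := (hf.differentiable (by simp) (x, t)).hasFDerivAt.comp_hasDerivAt t
    ((hasDerivAt_const t x).prodMk (hasDerivAt_id t))
  exact h.deriv

theorem contDiff_deriv_fst {f : ℝ → ℝ → ℝ} (hf : ContDiff ℝ ∞ fun p : ℝ × ℝ => f p.1 p.2) :
    ContDiff ℝ ∞ fun p : ℝ × ℝ => deriv (fun y => f y p.2) p.1 := by
  simp only [deriv_fst_eq_fderiv hf]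
  exact (hf.fderiv_right (m := ∞) (by simp)).clm_apply contDiff_const

theorem contDiff_deriv_snd {f : ℝ → ℝ → ℝ} (hf : ContDiff ℝ ∞ fun p : ℝ × ℝ => f p.1 p.2) :
    ContDiff ℝ ∞ fun p : ℝ × ℝ => deriv (fun s => f p.1 s) p.2 := by
  simp only [deriv_snd_eq_fderiv hf]
  exact (hf.fderiv_right (m := ∞) (by simp)).clm_apply contDiff_const

theorem deriv_comm {f : ℝ → ℝ → ℝ} (hf : ContDiff ℝ ∞ fun p : ℝ × ℝ => f p.1 p.2) (x t : ℝ) :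
    deriv (fun y => deriv (fun s => f y s) t) x = deriv (fun s => deriv (fun y => f y s) x) t := by
  rw [deriv_fst_eq_fderiv (f := fun y s => deriv (fun s => f y s) s) (contDiff_deriv_snd hf),
    deriv_snd_eq_fderiv (f := fun x s => deriv (fun y => f y s) x) (contDiff_deriv_fst hf)]
  simp only [deriv_snd_eq_fderiv hf, deriv_fst_eq_fderiv hf]
  have hd : DifferentiableAt ℝ (fderiv ℝ fun p : ℝ × ℝ => f p.1 p.2) (x, t) :=
    (hf.fderiv_right (m := ∞) (by simp)).differentiable (by simp) _
  have hsymm : IsSymmSndFDerivAt ℝ (fun p : ℝ × ℝ => f p.1 p.2) (x, t) :=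
    hf.contDiffAt.isSymmSndFDerivAt (by
      rw [minSmoothness_of_isRCLikeNormedField]; exact WithTop.coe_le_coe.2 (le_top : (2 : ℕ∞) ≤ ⊤))
  rw [fderiv_clm_apply hd (differentiableAt_const _), fderiv_clm_apply hd (differentiableAt_const _)]
  simpa using hsymm.eq (1, 0) (0, 1)

theorem SmoothMat.dx {F : ℝ → ℝ → Matrix (Fin n) (Fin n) ℝ} (hF : SmoothMat F) :
    SmoothMat (dx F) := fun i k => contDiff_deriv_fst (f := fun x t => F x t i k) (hF i k)

theorem SmoothMat.dt {F : ℝ → ℝ → Matrix (Fin n) (Fin n) ℝ} (hF : SmoothMat F) :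
    SmoothMat (dt F) := fun i k => contDiff_deriv_snd (f := fun x t => F x t i k) (hF i k)

theorem SmoothMat.dx_dt {F : ℝ → ℝ → Matrix (Fin n) (Fin n) ℝ} (hF : SmoothMat F) :
    CentralAffine.dx (CentralAffine.dt F) = CentralAffine.dt (CentralAffine.dx F) := by
  funext x t
  ext i k
  exact deriv_comm (f := fun x t => F x t i k) (hF i k) x t

theorem contDiff_det {E : Type*} [NormedAddCommGroup E] [NormedSpace ℝ E]
    {F : E → Matrix (Fin n) (Fin n) ℝ} (hF : ∀ i k, ContDiff ℝ ∞ fun p => F p i k) :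
    ContDiff ℝ ∞ fun p => (F p).det := by
  simp only [Matrix.det_apply']
  exact ContDiff.sum fun σ _ => contDiff_const.mul (contDiff_prod fun i _ => hF _ _)

theorem SmoothMat.adjugate {F : ℝ → ℝ → Matrix (Fin n) (Fin n) ℝ} (hF : SmoothMat F) :
    SmoothMat fun x t => (F x t).adjugate := fun i k => by
  simp only [Matrix.adjugate_apply]
  refine contDiff_det fun a c => ?_
  simp only [Matrix.updateRow_apply]
  split_ifs
  · exact contDiff_const
  · exact hF a c

/-- The derivative of a determinant, column by column. -/
theorem hasDerivAt_det {F : ℝ → Matrix (Fin n) (Fin n) ℝ} {F' : Matrix (Fin n) (Fin n) ℝ} {x : ℝ}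
    (hF : ∀ i k, HasDerivAt (fun y => F y i k) (F' i k) x) :
    HasDerivAt (fun y => (F y).det) (∑ k, ((F x).updateCol k fun i => F' i k).det) x := by
  simp only [Matrix.det_apply']
  rw [Finset.sum_comm]
  refine HasDerivAt.fun_sum fun σ _ => ?_
  rw [← Finset.mul_sum]
  refine HasDerivAt.const_mul _ ?_
  refine (HasDerivAt.fun_finsetProd fun k _ => hF (σ k) k).congr_deriv ?_
  refine Finset.sum_congr rfl fun k _ => ?_
  rw [← Finset.mul_prod_erase _ _ (Finset.mem_univ k), smul_eq_mul, mul_comm]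
  simp only [Matrix.updateCol_self]
  congr 1
  refine Finset.prod_congr rfl fun l hl => ?_
  rw [Matrix.updateCol_ne (Finset.ne_of_mem_erase hl)]

theorem cramer_mulVec (M : Matrix (Fin n) (Fin n) ℝ) (v : Fin n → ℝ) :
    M.cramer (M *ᵥ v) = M.det • v := by
  rw [Matrix.cramer_eq_adjugate_mulVec, Matrix.mulVec_mulVec, Matrix.adjugate_mul,
    Matrix.smul_mulVec, Matrix.one_mulVec]

/-- Liouville's formula: by Cramer's rule, replacing column `k` of `F` by column `k` of `F B`
multiplies the determinant by `B k k`. -/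
theorem hasDerivAt_det_of_mul {F : ℝ → Matrix (Fin n) (Fin n) ℝ} {B : Matrix (Fin n) (Fin n) ℝ}
    {x : ℝ} (hF : ∀ i k, HasDerivAt (fun y => F y i k) ((F x * B) i k) x) :
    HasDerivAt (fun y => (F y).det) ((F x).det * B.trace) x := by
  refine (hasDerivAt_det hF).congr_deriv ?_
  rw [Matrix.trace, Finset.mul_sum]
  refine Finset.sum_congr rfl fun k _ => ?_
  have h := congrFun (cramer_mulVec (F x) fun i => B i k) k
  rw [Matrix.cramer_apply] at h
  exact h

theorem det_eq_of_trace_eq_zero {F B : ℝ → Matrix (Fin n) (Fin n) ℝ}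
    (hF : ∀ x i k, HasDerivAt (fun y => F y i k) ((F x * B x) i k) x)
    (hB : ∀ x, (B x).trace = 0) (x y : ℝ) : (F x).det = (F y).det := by
  have h : ∀ x, HasDerivAt (fun y => (F y).det) 0 x := fun x => by
    simpa [hB] using hasDerivAt_det_of_mul (hF x)
  exact is_const_of_deriv_eq_zero (fun x => (h x).differentiableAt) (fun x => (h x).deriv) x y

theorem linear_matrix_solution_unique {A F G : ℝ → Matrix (Fin n) (Fin n) ℝ}
    (hA : ∀ i k, Continuous fun x => A x i k)
    (hF : ∀ x i k, HasDerivAt (fun y => F y i k) ((F x * A x) i k) x)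
    (hG : ∀ x i k, HasDerivAt (fun y => G y i k) ((G x * A x) i k) x) (h0 : F 0 = G 0) : F = G :=
  linear_solution_unique (continuous_matrix hA) (fun x => hasDerivAt_matrix_iff.2 (hF x))
    (fun x => hasDerivAt_matrix_iff.2 (hG x)) h0

variable {A Z g g' : ℝ → ℝ → Matrix (Fin n) (Fin n) ℝ}

theorem exists_zero_curvature_frame (hA : SmoothMat A) (hZ : SmoothMat Z)
    (h : ∀ x t, dt A x t = dx Z x t + (A x t * Z x t - Z x t * A x t))
    (c : Matrix (Fin n) (Fin n) ℝ) :
    ∃ g, SmoothMat g ∧ g 0 0 = c ∧ (∀ x t, dx g x t = g x t * A x t) ∧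
      ∀ x t, dt g x t = g x t * Z x t := by
  have : CompleteSpace (Matrix (Fin n) (Fin n) ℝ) := FiniteDimensional.complete ℝ _
  obtain ⟨g, hg, h0, hx, ht⟩ := exists_frobenius (smoothMat_iff.1 hA) (smoothMat_iff.1 hZ)
    (smoothMat_iff.1 hA.dt).continuous
    (fun x t => hasDerivAt_matrix_iff.2 fun i k => hA.hasDerivAt_snd x t i k)
    (fun x t => hasDerivAt_matrix_iff.2 fun i k => hZ.hasDerivAt_fst x t i k) h c
  refine ⟨g, smoothMat_iff.2 hg, h0, fun x t => ?_, fun x t => ?_⟩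
  · ext i k
    exact (hasDerivAt_matrix_iff.1 (hx x t) i k).deriv
  · ext i k
    exact (hasDerivAt_matrix_iff.1 (ht x t) i k).deriv

theorem zero_curvature_frame_unique (hA : SmoothMat A) (hZ : SmoothMat Z) (hg : SmoothMat g)
    (hg' : SmoothMat g') (hx : ∀ x t, dx g x t = g x t * A x t)
    (ht : ∀ x t, dt g x t = g x t * Z x t) (hx' : ∀ x t, dx g' x t = g' x t * A x t)
    (ht' : ∀ x t, dt g' x t = g' x t * Z x t) (h0 : g 0 0 = g' 0 0) : g = g' := by
  have h1 : (fun t => g 0 t) = fun t => g' 0 t :=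
    linear_matrix_solution_unique (fun i k => (hZ.slice_snd 0 i k).continuous)
      (fun t i k => ht 0 t ▸ hg.hasDerivAt_snd 0 t i k)
      (fun t i k => ht' 0 t ▸ hg'.hasDerivAt_snd 0 t i k) h0
  have h2 : ∀ t, (fun x => g x t) = fun x => g' x t := fun t =>
    linear_matrix_solution_unique (fun i k => (hA.slice_fst t i k).continuous)
      (fun x i k => hx x t ▸ hg.hasDerivAt_fst x t i k)
      (fun x i k => hx' x t ▸ hg'.hasDerivAt_fst x t i k) (congrFun h1 t)
  funext x t
  exact congrFun (h2 t) x

theorem det_zero_curvature_frame (hg : SmoothMat g) (hx : ∀ x t, dx g x t = g x t * A x t)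
    (ht : ∀ x t, dt g x t = g x t * Z x t) (hA : ∀ x t, (A x t).trace = 0)
    (hZ : ∀ x t, (Z x t).trace = 0) (x t : ℝ) : (g x t).det = (g 0 0).det :=
  (det_eq_of_trace_eq_zero (F := fun x => g x t) (B := fun x => A x t)
    (fun x i k => hx x t ▸ hg.hasDerivAt_fst x t i k) (fun x => hA x t) x 0).trans
  (det_eq_of_trace_eq_zero (F := fun t => g 0 t) (B := fun t => Z 0 t)
    (fun t i k => ht 0 t ▸ hg.hasDerivAt_snd 0 t i k) (fun t => hZ 0 t) t 0)

end MatrixCalculus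

/-! ### Moving frames and curvatures. -/

section Frames

variable {n : ℕ}

theorem trace_bMat_add_toV (v : Fin (n - 1) → ℝ) : (bMat n + toV n v).trace = 0 := by
  refine Finset.sum_eq_zero fun i _ => ?_
  simp only [Matrix.diag_apply, Matrix.add_apply, bMat, toV, Matrix.of_apply]
  split_ifs <;> first | omega | simp

theorem mulVec_e1 (h : 0 < n) (M : Matrix (Fin n) (Fin n) ℝ) : M *ᵥ e1 n = M.col ⟨0, h⟩ := by
  rw [← Matrix.mulVec_single_one]
  congr 1
  ext i
  simp [e1, Pi.single_apply, Fin.ext_iff]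

theorem hasDerivAt_iteratedDeriv {γ : ℝ → Fin n → ℝ} (hγ : ContDiff ℝ ∞ γ) (k : ℕ) (x : ℝ)
    (i : Fin n) :
    HasDerivAt (fun y => iteratedDeriv k γ y i) (iteratedDeriv (k + 1) γ x i) x := by
  have h : Differentiable ℝ (iteratedDeriv k γ) :=
    hγ.differentiable_iteratedDeriv k (by exact_mod_cast WithTop.coe_lt_top _)
  have h1 := (h x).hasDerivAt
  rw [← iteratedDeriv_succ] at h1
  exact hasDerivAt_pi.1 h1 i

/-- The structure equation `gₓ = g (b + u)` of the central affine moving frame. -/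
theorem hasDerivAt_frame {γ : ℝ → Fin n → ℝ} (hγ : IsCentralAffineCurve γ) (x : ℝ)
    (i k : Fin n) :
    HasDerivAt (fun y => frame γ y i k)
      ((frame γ x * (bMat n + toV n (curvature γ x))) i k) x := by
  have hd : ∀ i k : Fin n, HasDerivAt (fun y => frame γ y i k) (iteratedDeriv (k + 1) γ x i) x :=
    fun i k => hasDerivAt_iteratedDeriv hγ.1 k x i
  refine (hd i k).congr_deriv ?_
  rcases (by omega : k.val + 1 < n ∨ k.val + 1 = n) with hk | hk
  · exact (mul_bMat_add_toV_apply (frame γ x) (curvature γ x) i hk).symm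
  have hkn : iteratedDeriv n γ x = iteratedDeriv (k.val + 1) γ x := by rw [hk]
  set w := (frame γ x).cramer (iteratedDeriv n γ x) with hw
  -- Differentiating `det = 1`, every column but the last is replaced by a copy of its neighbour and
  -- contributes zero. The remaining term is the last Cramer coordinate of `γₓ^{(n)}`, which
  -- explains why there are only `n - 1` curvatures.
  have hwk : w k = 0 := by
    have h1 : HasDerivAt (fun y => (frame γ y).det) 0 x := by
      rw [show (fun y => (frame γ y).det) = fun _ => 1 from funext hγ.2]
      exact hasDerivAt_const _ _
    have h2 := (hasDerivAt_det fun i k => hd i k).unique h1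
    rw [Finset.sum_eq_single k] at h2
    · rw [hw, Matrix.cramer_apply, ← h2, hkn]
    · intro l _ hl
      have hl1 : l.val + 1 < n := by
        have := Fin.val_ne_of_ne hl
        omega
      have hne : (⟨l.val + 1, hl1⟩ : Fin n) ≠ l := fun h => by simp [Fin.ext_iff] at h
      refine Matrix.det_zero_of_column_eq hne fun a => ?_
      rw [Matrix.updateCol_self, Matrix.updateCol_ne hne]
      rfl
    · exact fun h => absurd (Finset.mem_univ _) h
  have hcol : ∀ l, (bMat n + toV n (curvature γ x)) l k = w l := by
    intro l
    have hl := l.isLt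
    by_cases hlk : l.val < n - 1
    · simp [bMat, toV, hk, hlk, hl.ne, hw, Matrix.cramer_apply, curvature]
    · obtain rfl : l = k := Fin.ext (by omega)
      simp [bMat, toV, hlk, hwk]
  have hmul := congrFun (Matrix.mulVec_cramer (frame γ x) (iteratedDeriv n γ x)) i
  rw [hγ.2, one_smul] at hmul
  rw [← hkn, ← hmul, Matrix.mul_apply]
  simp only [hcol]
  rfl

variable {G : ℝ → Matrix (Fin n) (Fin n) ℝ} {v : ℝ → Fin (n - 1) → ℝ}

theorem iteratedDeriv_mulVec_e1 (hn : 0 < n)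
    (hG : ∀ x i k, HasDerivAt (fun y => G y i k) ((G x * (bMat n + toV n (v x))) i k) x)
    {k : ℕ} (hk : k < n) : iteratedDeriv k (fun y => G y *ᵥ e1 n) = fun x => (G x).col ⟨k, hk⟩ := by
  induction k with
  | zero =>
    rw [iteratedDeriv_zero]
    exact funext fun x => mulVec_e1 hn _
  | succ k ih =>
    rw [iteratedDeriv_succ, ih (by omega)]
    funext x
    refine HasDerivAt.deriv (hasDerivAt_pi.2 fun i => ?_)
    have := hG x i ⟨k, by omega⟩
    rwa [mul_bMat_add_toV_apply _ _ _ hk] at this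

theorem frame_mulVec_e1 (hn : 0 < n)
    (hG : ∀ x i k, HasDerivAt (fun y => G y i k) ((G x * (bMat n + toV n (v x))) i k) x) :
    frame (fun y => G y *ᵥ e1 n) = G := by
  funext x
  ext i k
  exact congrFun (congrFun (iteratedDeriv_mulVec_e1 hn hG k.isLt) x) i

/-- The `n`-th derivative is `G` applied to the last column of `b + v`; Cramer's rule with
determinant `1` recovers its coordinates. -/
theorem curvature_mulVec_e1 (hn : 0 < n)
    (hG : ∀ x i k, HasDerivAt (fun y => G y i k) ((G x * (bMat n + toV n (v x))) i k) x)
    (hdet : ∀ x, (G x).det = 1) : curvature (fun y => G y *ᵥ e1 n) = v := by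
  obtain ⟨m, rfl⟩ := Nat.exists_eq_succ_of_ne_zero hn.ne'
  have h1 : ∀ x, iteratedDeriv (m + 1) (fun y => G y *ᵥ e1 (m + 1)) x =
      G x *ᵥ fun l => (bMat (m + 1) + toV (m + 1) (v x)) l (Fin.last m) := by
    intro x
    rw [iteratedDeriv_succ, iteratedDeriv_mulVec_e1 hn hG (Nat.lt_succ_self m)]
    exact HasDerivAt.deriv (hasDerivAt_pi.2 fun i => hG x i (Fin.last m))
  funext x i
  have hi := i.isLt
  have h2 := congrFun (cramer_mulVec (G x)
    fun l => (bMat (m + 1) + toV (m + 1) (v x)) l (Fin.last m)) ⟨i.val, by omega⟩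
  rw [Matrix.cramer_apply, ← h1, hdet, one_smul] at h2
  rw [curvature, frame_mulVec_e1 hn hG]
  refine h2.trans ?_
  have h3 : i.val < m := hi
  have h4 : i.val ≠ m + 1 := by omega
  simp [bMat, toV, h3, h4]

theorem contDiff_iteratedDeriv_fst {γ : ℝ → ℝ → Fin n → ℝ}
    (hγ : ContDiff ℝ ∞ fun p : ℝ × ℝ => γ p.1 p.2) (k : ℕ) (i : Fin n) :
    ContDiff ℝ ∞ fun p : ℝ × ℝ => iteratedDeriv k (fun y => γ y p.2) p.1 i := by
  induction k with
  | zero => simpa using contDiff_pi.1 hγ i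
  | succ k ih =>
    have h := contDiff_deriv_fst (f := fun x t => iteratedDeriv k (fun y => γ y t) x i) ih
    have hd : ∀ p : ℝ × ℝ, iteratedDeriv (k + 1) (fun y => γ y p.2) p.1 i =
        deriv (fun y => iteratedDeriv k (fun y => γ y p.2) y i) p.1 := fun p =>
      (hasDerivAt_iteratedDeriv (hγ.comp (contDiff_id.prodMk contDiff_const)) k p.1 i).deriv.symm
    simpa only [hd] using h

end Frames

end CentralAffine

namespace CentralAffine

/-! ### From the KdV flow to the curve flow and back. -/

section Flows

variable {n j : ℕ}

theorem smoothMat_bMat_add_toV {u : ℝ → ℝ → Fin (n - 1) → ℝ}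
    (hu : ContDiff ℝ ∞ fun p : ℝ × ℝ => u p.1 p.2) :
    SmoothMat fun x t => bMat n + toV n (u x t) := by
  refine (SmoothMat.const (bMat n)).add fun i k => ?_
  simp only [toV, Matrix.of_apply]
  split_ifs with hk hi
  · exact contDiff_pi.1 hu _
  · exact contDiff_const
  · exact contDiff_const

theorem dt_bMat_add_toV (u : ℝ → ℝ → Fin (n - 1) → ℝ) (x t : ℝ) :
    dt (fun x t => bMat n + toV n (u x t)) x t = dt (fun x t => toV n (u x t)) x t := by
  ext i k
  exact deriv_const_add _

theorem dt_toV (u : ℝ → ℝ → Fin (n - 1) → ℝ) (x t : ℝ) :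
    ∃ w, dt (fun x t => toV n (u x t)) x t = toV n w := by
  refine ⟨fun i => deriv (fun s => u x s i) t, ?_⟩
  ext i k
  simp only [dt, toV, Matrix.of_apply]
  split_ifs <;> simp

theorem eq_mul_of_inv_mul_eq {g M N : Matrix (Fin n) (Fin n) ℝ} (hg : g.det = 1)
    (h : g⁻¹ * M = N) : M = g * N := by
  rw [← h, Matrix.mul_nonsing_inv_cancel_left _ _ (by rw [hg]; exact isUnit_one)]

theorem inv_mul_eq_of_eq_mul {g M N : Matrix (Fin n) (Fin n) ℝ} (hg : g.det = 1)
    (h : M = g * N) : g⁻¹ * M = N := by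
  rw [h, Matrix.nonsing_inv_mul_cancel_left _ _ (by rw [hg]; exact isUnit_one)]

theorem IsLaxFrame.eq (hn : 2 ≤ n) {u : ℝ → ℝ → Fin (n - 1) → ℝ}
    (hu : ContDiff ℝ ∞ fun p : ℝ × ℝ => u p.1 p.2) {g g' : ℝ → ℝ → Matrix (Fin n) (Fin n) ℝ}
    (hg : IsLaxFrame j u g) (hg' : IsLaxFrame j u g') (h0 : g 0 0 = g' 0 0) : g = g' := by
  obtain ⟨hs, hd, hx, Z, hZ, ht⟩ := hg
  obtain ⟨hs', hd', hx', Z', hZ', ht'⟩ := hg'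
  obtain rfl := hZ.unique hn hZ'
  exact zero_curvature_frame_unique (smoothMat_bMat_add_toV hu) hZ.smooth hs hs'
    (fun x t => eq_mul_of_inv_mul_eq (hd x t) (hx x t))
    (fun x t => eq_mul_of_inv_mul_eq (hd x t) (ht x t))
    (fun x t => eq_mul_of_inv_mul_eq (hd' x t) (hx' x t))
    (fun x t => eq_mul_of_inv_mul_eq (hd' x t) (ht' x t)) h0

theorem IsKdVSolution.exists_laxFrame (hn : n ≠ 0) (hj : j ≠ 0) {u : ℝ → ℝ → Fin (n - 1) → ℝ}
    (hu : IsKdVSolution j u) {c : Matrix (Fin n) (Fin n) ℝ} (hc : c.det = 1) :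
    ∃ g, IsLaxFrame j u g ∧ g 0 0 = c := by
  obtain ⟨hus, Z, hZ, hut⟩ := hu
  obtain ⟨g, hg, h0, hx, ht⟩ := exists_zero_curvature_frame (smoothMat_bMat_add_toV hus) hZ.smooth
    (fun x t => by rw [dt_bMat_add_toV, hut]; rfl) c
  have hdet : ∀ x t, (g x t).det = 1 := fun x t => by
    rw [det_zero_curvature_frame hg hx ht (fun x t => trace_bMat_add_toV _)
      (hZ.trace_eq_zero hn hj), h0, hc]
  exact ⟨g, ⟨hg, hdet, fun x t => inv_mul_eq_of_eq_mul (hdet x t) (hx x t), Z, hZ,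
    fun x t => inv_mul_eq_of_eq_mul (hdet x t) (ht x t)⟩, h0⟩

section LaxFrame

variable {u : ℝ → ℝ → Fin (n - 1) → ℝ} {g : ℝ → ℝ → Matrix (Fin n) (Fin n) ℝ}

theorem IsLaxFrame.hasDerivAt_fst (hg : IsLaxFrame j u g) (t x : ℝ) (i k : Fin n) :
    HasDerivAt (fun y => g y t i k) ((g x t * (bMat n + toV n (u x t))) i k) x := by
  obtain ⟨hs, hd, hx, -⟩ := hg
  rw [← eq_mul_of_inv_mul_eq (hd x t) (hx x t)]
  exact hs.hasDerivAt_fst x t i k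

theorem IsLaxFrame.frame_eq (hn : 0 < n) (hg : IsLaxFrame j u g) (t : ℝ) :
    frame (fun y => g y t *ᵥ e1 n) = fun x => g x t :=
  frame_mulVec_e1 hn (hg.hasDerivAt_fst t)

theorem IsLaxFrame.curvature_eq (hn : 0 < n) (hg : IsLaxFrame j u g) (t : ℝ) :
    curvature (fun y => g y t *ᵥ e1 n) = fun x => u x t :=
  curvature_mulVec_e1 hn (hg.hasDerivAt_fst t) fun x => hg.2.1 x t

theorem IsLaxFrame.isCurveFlowSolution (hn : 0 < n) (hg : IsLaxFrame j u g) :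
    IsCurveFlowSolution j fun x t => g x t *ᵥ e1 n := by
  have hfr := hg.frame_eq hn
  have hcurv : (fun x t => curvature (fun y => g y t *ᵥ e1 n) x) = u := by
    funext x t
    exact congrFun (hg.curvature_eq hn t) x
  obtain ⟨hs, hd, -, Z, hZ, ht⟩ := hg
  have hsm : ContDiff ℝ ∞ fun p : ℝ × ℝ => g p.1 p.2 *ᵥ e1 n := by
    simp only [mulVec_e1 hn]
    exact contDiff_pi.2 fun i => hs i _
  refine ⟨hsm, fun t => ⟨hsm.comp (contDiff_id.prodMk contDiff_const), fun x => ?_⟩, Z,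
    hcurv ▸ hZ, fun x t => ?_⟩
  · rw [hfr]
    exact hd x t
  · rw [hfr, ← eq_mul_of_inv_mul_eq (hd x t) (ht x t)]
    simp only [mulVec_e1 hn]
    exact (hasDerivAt_pi.2 fun i => hs.hasDerivAt_snd x t i _).deriv

end LaxFrame

theorem eq_of_curvature_eq (hn : 0 < n) {G : ℝ → Matrix (Fin n) (Fin n) ℝ} {γ : ℝ → Fin n → ℝ}
    (hγ : IsCentralAffineCurve γ) (hc : ∀ i k, Continuous fun x =>
      (bMat n + toV n (curvature γ x)) i k)
    (hG : ∀ x i k, HasDerivAt (fun y => G y i k)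
      ((G x * (bMat n + toV n (curvature γ x))) i k) x) (h0 : G 0 = frame γ 0) (x : ℝ) :
    G x *ᵥ e1 n = γ x := by
  rw [linear_matrix_solution_unique hc hG (hasDerivAt_frame hγ) h0, mulVec_e1 hn]
  ext i
  simp [frame]

/-- The central affine curvature of a solution of the curve flow solves the KdV flow, and its
central affine moving frame solves the Lax system. -/
theorem IsCurveFlowSolution.isKdVSolution (hn : 0 < n) {γ : ℝ → ℝ → Fin n → ℝ}
    (hγ : IsCurveFlowSolution j γ) :
    IsKdVSolution j (fun x t => curvature (fun y => γ y t) x) ∧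
      IsLaxFrame j (fun x t => curvature (fun y => γ y t) x)
        (fun x t => frame (fun y => γ y t) x) := by
  obtain ⟨hs, hcurve, Z, hZ, hflow⟩ := hγ
  set v : ℝ → ℝ → Fin (n - 1) → ℝ := fun x t => curvature (fun y => γ y t) x with hv
  set g : ℝ → ℝ → Matrix (Fin n) (Fin n) ℝ := fun x t => frame (fun y => γ y t) x with hg
  have hgs : SmoothMat g := fun i k => contDiff_iteratedDeriv_fst hs k i
  have hdet : ∀ x t, (g x t).det = 1 := fun x t => (hcurve t).2 x
  have hvs : ContDiff ℝ ∞ fun p : ℝ × ℝ => v p.1 p.2 := by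
    refine contDiff_pi.2 fun i => contDiff_det fun a c => ?_
    simp only [Matrix.updateCol_apply]
    split_ifs
    · exact contDiff_iteratedDeriv_fst hs n a
    · exact hgs a c
  have hA := smoothMat_bMat_add_toV hvs
  have hgx : ∀ x t, dx g x t = g x t * (bMat n + toV n (v x t)) := by
    intro x t
    ext i k
    exact (hasDerivAt_frame (hcurve t) x i k).deriv
  -- This is `g⁻¹ gₜ`; the adjugate is polynomial in the entries, so smoothness is immediate.
  set C : ℝ → ℝ → Matrix (Fin n) (Fin n) ℝ := fun x t => (g x t).adjugate * dt g x t with hC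
  have hCs : SmoothMat C := hgs.adjugate.mul hgs.dt
  have hgC : ∀ x t, g x t * C x t = dt g x t := by
    intro x t
    rw [hC, ← mul_assoc, Matrix.mul_adjugate, hdet, one_smul, one_mul]
  clear_value C
  have hcancel : ∀ x t (M N : Matrix (Fin n) (Fin n) ℝ), g x t * M = g x t * N → M = N := by
    intro x t M N h
    have := congrArg ((g x t).adjugate * ·) h
    simpa only [← mul_assoc, Matrix.adjugate_mul, hdet, one_smul, one_mul] using this
  -- Compare the two mixed derivatives of `g`, computed from `gₜ = g C` and from `gₓ = g (b + v)`,
  -- and cancel `g`.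
  have hzero : ∀ x t, dt (fun x t => toV n (v x t)) x t = bracket v C x t := by
    intro x t
    have h1 : dx (fun x t => g x t * C x t) x t = dx (dt g) x t := by
      rw [show (fun x t => g x t * C x t) = dt g from funext fun x => funext fun t => hgC x t]
    have h2 : dt (dx g) x t = dt (fun x t => g x t * (bMat n + toV n (v x t))) x t := by
      rw [show dx g = fun x t => g x t * (bMat n + toV n (v x t)) from
        funext fun x => funext fun t => hgx x t]
    rw [hgs.dx_dt, h2, dx_mul hgs hCs, dt_mul hgs hA, dt_bMat_add_toV, ← hgC, hgx] at h1
    refine hcancel x t _ _ ?_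
    rw [bracket, mul_add, mul_sub, ← mul_assoc, ← mul_assoc, eq_sub_of_add_eq' h1.symm]
    abel
  -- Both brackets lie in `Vₙ`, that of `C` because it is a `t`-derivative of elements of `Vₙ`. The
  -- first columns agree since the flow prescribes `gₜ e₁`.
  have hCZ : C = Z := by
    refine eq_of_bracket_mem (u := v) hCs hZ.smooth ?_ (fun x t => ?_) hZ.bracket_mem
    · intro x t i k hk
      have h1 : g x t *ᵥ (C x t *ᵥ e1 n) = g x t *ᵥ (Z x t *ᵥ e1 n) := by
        rw [Matrix.mulVec_mulVec, Matrix.mulVec_mulVec, hgC, ← hflow x t, mulVec_e1 hn]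
        ext a
        have h2 : HasDerivAt (fun s => γ x s) (fun a => deriv (fun s => γ x s a) t) t :=
          hasDerivAt_pi.2 fun a =>
            ((contDiff_slice_snd (f := fun x t => γ x t a) (contDiff_pi.1 hs a) x).differentiable
              (by simp) t).hasDerivAt
        rw [h2.deriv]
        simp [dt, hg, frame]
      have h2 := congrArg ((g x t).adjugate *ᵥ ·) h1
      simp only [Matrix.mulVec_mulVec, ← mul_assoc,
        Matrix.adjugate_mul, hdet, one_smul, one_mul] at h2
      rw [mulVec_e1 hn, mulVec_e1 hn] at h2
      obtain rfl : k = ⟨0, hn⟩ := Fin.ext hk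
      exact congrFun h2 i
    · obtain ⟨w, hw⟩ := dt_toV v x t
      exact ⟨w, by rw [← hzero, hw]⟩
  exact ⟨⟨hvs, Z, hZ, hCZ ▸ hzero⟩, hgs, hdet, fun x t => inv_mul_eq_of_eq_mul (hdet x t) (hgx x t),
    Z, hZ, fun x t => inv_mul_eq_of_eq_mul (hdet x t) (by rw [← hCZ, hgC])⟩

end Flows

end CentralAffine

theorem mainTheorem3 (n j : ℕ) (hn : 2 ≤ n) (hj : 1 ≤ j) (hjn : ¬ n ∣ j)
    (γ₀ : ℝ → Fin n → ℝ) (hγ₀ : CentralAffine.IsCentralAffineCurve γ₀)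
    (hdecay : ∀ i, CentralAffine.RapidlyDecaying fun x => CentralAffine.curvature γ₀ x i)
    (u : ℝ → ℝ → Fin (n - 1) → ℝ)
    (hu : CentralAffine.SolvesKdVCauchy j (CentralAffine.curvature γ₀) u) :
    ∃ g : ℝ → ℝ → Matrix (Fin n) (Fin n) ℝ,
      -- `g` is the solution of the Lax system with `g(0,0) = g₀(0)`
      (CentralAffine.IsLaxFrame j u g ∧ g 0 0 = CentralAffine.frame γ₀ 0) ∧
      (∀ g' : ℝ → ℝ → Matrix (Fin n) (Fin n) ℝ,
        CentralAffine.IsLaxFrame j u g' → g' 0 0 = CentralAffine.frame γ₀ 0 → g' = g) ∧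
      -- `γ = g e₁` solves the Cauchy problem of the curve flow
      CentralAffine.IsCurveFlowSolution j (fun x t => g x t *ᵥ CentralAffine.e1 n) ∧
      (∀ x, g x 0 *ᵥ CentralAffine.e1 n = γ₀ x) ∧
      -- its central affine curvatures are rapidly decaying at each time
      (∀ t i, CentralAffine.RapidlyDecaying fun x =>
        CentralAffine.curvature (fun y => g y t *ᵥ CentralAffine.e1 n) x i) ∧
      -- if `u` is the only solution of its Cauchy problem, then so is `γ`
      ((∀ v, CentralAffine.SolvesKdVCauchy j (CentralAffine.curvature γ₀) v → v = u) →
        ∀ γ : ℝ → ℝ → Fin n → ℝ, CentralAffine.IsCurveFlowSolution j γ →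
          (∀ t i, CentralAffine.RapidlyDecaying fun x =>
            CentralAffine.curvature (fun y => γ y t) x i) →
          (∀ x, γ x 0 = γ₀ x) → γ = fun x t => g x t *ᵥ CentralAffine.e1 n) := by
  have hn0 : 0 < n := by omega
  obtain ⟨hkdv, hudecay, hu0⟩ := hu
  obtain ⟨g, hg, hg0⟩ := hkdv.exists_laxFrame (by omega) (by omega) (hγ₀.2 0)
  have hcurv := hg.curvature_eq hn0
  refine ⟨g, ⟨hg, hg0⟩, fun g' hg' h0 => hg'.eq hn hkdv.1 hg (h0.trans hg0.symm),
    hg.isCurveFlowSolution hn0, ?_, fun t i => ?_, fun huniq γ hγ hdec hγ0 => ?_⟩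
  · refine CentralAffine.eq_of_curvature_eq hn0 (G := fun x => g x 0) hγ₀ (fun i k => ?_)
      (fun x i k => ?_) hg0
    · simp only [← hu0]
      exact ((CentralAffine.smoothMat_bMat_add_toV hkdv.1).slice_fst 0 i k).continuous
    · rw [← hu0]
      exact hg.hasDerivAt_fst 0 x i k
  · rw [hcurv]
    exact hudecay t i
  · obtain ⟨hv, hfr⟩ := hγ.isKdVSolution hn0
    have hγ0' : (fun y => γ y 0) = γ₀ := funext hγ0
    -- KdV uniqueness identifies the curvature with `u`; both frames then solve one Lax system with
    -- the same value at the origin.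
    have hvu := huniq _ ⟨hv, hdec, fun x => by simp only [hγ0']⟩
    rw [hvu] at hfr
    have hgg := hfr.eq hn hkdv.1 hg (by simp only [hγ0', hg0])
    funext x t
    rw [← hgg, CentralAffine.mulVec_e1 hn0]
    ext i
    simp [CentralAffine.frame]
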